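/- Setting. $\mathcal S$ (contexts) and $\mathcal A$ (actions) are measurable spaces, $P_S$ is a distribution on $\mathcal S$, $P_R(\cdot\mid s,a)$ is a distribution on $\mathbb R$ for every $(s,a)$, and $\pi_b,\pi_e$ (behavior and target policy) are stochastic policies with conditional densities $\pi_b(a\mid s)$, $\pi_e(a\mid s)$ with respect to a common reference measure on $\mathcal A$ (which may depend on $s$). Assume $B:=\inf\{b:\pi_e(a\mid s)\le b\,\pi_b(a\mid s)\text{ for all }(s,a)\}<\infty$ and put $w(s,a)=\pi_e(a\mid s)/\pi_b(a\mid s)$, with $0/0=0$. For $n\ge 1$ let $(S_i,A_i,R_i)$, $i=1,\dots,n$, be i.i.d. with $S_i\sim P_S$, $A_i\sim\pi_b(\cdot\mid S_i)$, $R_i\sim P_R(\cdot\mid S_i,A_i)$, and let $V_1,\dots,V_n$ be i.i.d. uniform on $[0,1]$, independent of these data. Let $P^{\pi_e}$ be the law of $(S,R)$ when $S\sim P_S$, $A\sim\pi_e(\cdot\mid S)$, $R\sim P_R(\cdot\mid S,A)$. Fix $\epsilon,\delta,\gamma\in(0,1)$. Algorithm. (0) Keep the pairs $(S_i,R_i)$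 with $V_i\le w(S_i,A_i)/B$; let $N_{\mathrm{rs}}$ be their number. (1) Split the kept pairs, by a rule which does not look at their values (possibly randomized, independently of the data and of the $V_i$), into a calibration set of size $M=\lceil\gamma N_{\mathrm{rs}}\rceil$ and a training set of size $N_{\mathrm{rs}}-M$. (2) From the training set compute functions $\hat q_{\mathrm{lo}},\hat q_{\mathrm{up}}:\mathcal S\to\mathbb R$ by any (measurable, non-randomized) quantile estimation algorithms, and put $\hat C_\tau(s)=[\hat q_{\mathrm{lo}}(s)-\tau,\hat q_{\mathrm{up}}(s)+\tau]$, $\hat C_\infty(s)=\mathbb R$. (3) For the pairs in the calibration set let $\tau_i=\max\{\hat q_{\mathrm{lo}}(S_i)-R_i,\,R_i-\hat q_{\mathrm{up}}(S_i)\}$, let $\tau_{(1)}\le\dots\le\tau_{(M)}$ be these scores in increasing order and $\tau_{(M+1)}=\infty$; let $F_{\mathrm{Bin}(M,\epsilon)}$ be the distribution function of the binomial distribution, $k=\max\{k\in\{-1,0,\dots,M-1\}:F_{\mathrm{Bin}(M,\epsilon)}(k)\le\delta\}$, and $\tilde\tau=\tau_{(M-k)}$. The output is $\hat C_{\tilde\tau}$.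 Its miscoverage is $L(\hat C_{\tilde\tau})=P^{\pi_e}\{(s,r):r\notin\hat C_{\tilde\tau}(s)\}$, computed for the realized (random) set-valued map $\hat C_{\tilde\tau}$. Theorem. Suppose that almost surely there are no ties among the scores $\tau_i$ of the calibration set. Then for every $\Delta_\epsilon\in(0,\epsilon)$ and every $n\ge1$, $$\mathbb P\left[\epsilon-\Delta_\epsilon<L(\hat C_{\tilde\tau})\le\epsilon\right]>1-\delta-\frac{C}{\sqrt n},$$ where $$C=\frac{7B}{\sqrt{\gamma(\epsilon-\Delta_\epsilon)(1-\epsilon+\Delta_\epsilon)}}+\frac{(\sqrt{-2\log\delta}+1)B}{2\Delta_\epsilon\sqrt\gamma}+(1-\delta)\left(\sqrt{\lfloor m_1/\gamma\rfloor B}+\frac B2\right),\qquad m_1=\max\left\{\log_{1-\epsilon}\delta,\ \frac{\log\delta}{-2\Delta_\epsilon^2}\right\}.$$ -/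

import Mathlib

open MeasureTheory ProbabilityTheory
open scoped NNReal ENNReal

noncomputable section

namespace PACOPP

/-- A stochastic policy, given by its conditional densities `a ↦ π(a | s)` with respect to a
reference measure `ν s` on the action space.  (A constant kernel `ν` is one fixed reference
measure, such as counting or Lebesgue measure; letting `ν` depend on `s` also covers pairs of
policies without a common dominating measure.) -/
structure Policy {𝒮 𝒜 : Type*} [MeasurableSpace 𝒮] [MeasurableSpace 𝒜] (ν : Kernel 𝒮 𝒜) where
  /-- the density `π(a | s)` -/
  dens : 𝒮 → 𝒜 → ℝ≥0
  measurable_dens : Measurable (Function.uncurry dens)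
  lintegral_dens : ∀ s, ∫⁻ a, (dens s a : ℝ≥0∞) ∂(ν s) = 1

section Bandit

variable {𝒮 𝒜 : Type*} [MeasurableSpace 𝒮] [MeasurableSpace 𝒜] {ν : Kernel 𝒮 𝒜}

/-- The kernel `s ↦ π(· | s)` of a policy. -/
def Policy.kernel [IsSFiniteKernel ν] (π : Policy ν) : Kernel 𝒮 𝒜 :=
  ν.withDensity (fun s a => (π.dens s a : ℝ≥0∞))

/-- The kernel of a policy is Markov: every `π(· | s)` is a probability measure. -/
instance Policy.isMarkovKernel_kernel [IsSFiniteKernel ν] (π : Policy ν) :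
    IsMarkovKernel π.kernel := by
  refine ⟨fun s => ⟨?_⟩⟩
  have hm : Measurable (Function.uncurry fun s a => (π.dens s a : ℝ≥0∞)) :=
    π.measurable_dens.coe_nnreal_ennreal
  rw [Policy.kernel, Kernel.withDensity_apply' _ hm, setLIntegral_univ]
  exact π.lintegral_dens s

/-- The law of `((S, A), R)` with `S ∼ P_S`, `A ∼ π(· | S)`, `R ∼ P_R(· | S, A)`. -/
def obsLaw [IsSFiniteKernel ν] (PS : Measure 𝒮) (PR : Kernel (𝒮 × 𝒜) ℝ) (π : Policy ν) :
    Measure ((𝒮 × 𝒜) × ℝ) :=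
  (PS ⊗ₘ π.kernel) ⊗ₘ PR

/-- The context-reward pair of an observation `((s, a), r)`. -/
def contextReward (x : (𝒮 × 𝒜) × ℝ) : 𝒮 × ℝ := (x.1.1, x.2)

/-- The law `P^π` of the context-reward pair `(S, R)` under the policy `π`. -/
def contextRewardLaw [IsSFiniteKernel ν] (PS : Measure 𝒮) (PR : Kernel (𝒮 × 𝒜) ℝ)
    (π : Policy ν) : Measure (𝒮 × ℝ) :=
  (obsLaw PS PR π).map contextReward

/-- The numbers `b` with `π_e(a | s) ≤ b π_b(a | s)` for all `(s, a)`. -/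
def ratioBounds (πe πb : Policy ν) : Set ℝ≥0 :=
  {b | ∀ s a, πe.dens s a ≤ b * πb.dens s a}

/-- `B = inf {b : π_e(a | s) ≤ b π_b(a | s) for all (s, a)}`. -/
def ratioBound (πe πb : Policy ν) : ℝ≥0 := sInf (ratioBounds πe πb)

/-- The weight `w(s, a) = π_e(a | s) / π_b(a | s)`, with `0 / 0 = 0`. -/
def weight (πe πb : Policy ν) (s : 𝒮) (a : 𝒜) : ℝ≥0 := πe.dens s a / πb.dens s a

open Classical in
/-- Rejection sampling: the indices `i` with `V_i ≤ w(S_i, A_i) / B`. -/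
def accepted (πe πb : Policy ν) {n : ℕ} (x : Fin n → (𝒮 × 𝒜) × ℝ) (v : Fin n → ℝ) :
    Finset (Fin n) :=
  Finset.univ.filter
    (fun i => v i ≤ 1 / (ratioBound πe πb : ℝ) * (weight πe πb (x i).1.1 (x i).1.2 : ℝ))

/-- The context-reward pairs with index in `T`, listed by increasing index. -/
def pairs {n : ℕ} (x : Fin n → (𝒮 × 𝒜) × ℝ) (T : Finset (Fin n)) : List (𝒮 × ℝ) :=
  (T.sort (· ≤ ·)).map (fun i => contextReward (x i))

end Bandit

/-- The cumulative distribution function of `Bin(M, p)` at an integer. -/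
def binCDF (M : ℕ) (p : ℝ) (k : ℤ) : ℝ :=
  ∑ i ∈ (Finset.range (M + 1)).filter (fun i : ℕ => (i : ℤ) ≤ k),
    (M.choose i : ℝ) * p ^ i * (1 - p) ^ (M - i)

/-- `k(M, ε, δ) = max {k ∈ {-1, 0, …, M - 1} : F_{Bin(M, ε)}(k) ≤ δ}`. -/
def cutoff (M : ℕ) (ε δ : ℝ) : ℤ :=
  sSup {k : ℤ | -1 ≤ k ∧ k ≤ (M : ℤ) - 1 ∧ binCDF M ε k ≤ δ}

/-- The `j`-th smallest (`j = 1, …, M`) of the `M` numbers in `t`, and `∞` for `j = M + 1`. -/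
def orderStat (t : Multiset ℝ) (j : ℕ) : EReal :=
  ((t.sort (· ≤ ·)).map (fun y : ℝ => (y : EReal))).getD (j - 1) ⊤

/-- The threshold `τ_{(M - k(M, ε, δ))}` of the `M` scores in `t`. -/
def threshold (ε δ : ℝ) (t : Multiset ℝ) : EReal :=
  orderStat t ((t.card : ℤ) - cutoff t.card ε δ).toNat

/-- The interval `[q_lo(s) - τ, q_up(s) + τ]`; it is all of `ℝ` for `τ = ∞`, and may be empty. -/
def interval {𝒮 : Type*} (qlo qup : 𝒮 → ℝ) (τ : EReal) (s : 𝒮) : Set ℝ :=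
  {r : ℝ | (qlo s : EReal) - τ ≤ (r : EReal) ∧ (r : EReal) ≤ (qup s : EReal) + τ}

/-- The non-conformity score `max {q_lo(s) - r, r - q_up(s)}`. -/
def score {𝒮 : Type*} (qlo qup : 𝒮 → ℝ) (z : 𝒮 × ℝ) : ℝ :=
  max (qlo z.1 - z.2) (z.2 - qup z.1)

/-- The miscoverage `L_P(C) = P {(s, r) : r ∉ C(s)}` of a set-valued map `C`. -/
def miscoverage {𝒮 : Type*} [MeasurableSpace 𝒮] (P : Measure (𝒮 × ℝ)) (C : 𝒮 → Set ℝ) : ℝ :=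
  P.real {z | z.2 ∉ C z.1}

/-- A rule for splitting the accepted sample: out of the set `J` of accepted indices, and with
the auxiliary randomness `g`, it selects the set `calib g J ⊆ J` of calibration indices, of size
`⌈γ |J|⌉`; the other elements of `J` are the training indices.  The rule does not look at the
values of the data.  Deterministic rules do not depend on `g`. -/
structure SplitRule (γ : ℝ) (n : ℕ) (𝒢 : Type*) [MeasurableSpace 𝒢] where
  /-- the calibration indices -/
  calib : 𝒢 → Finset (Fin n) → Finset (Fin n)
  calib_subset : ∀ g J, calib g J ⊆ J
  card_calib : ∀ g J, (calib g J).card = ⌈γ * (J.card : ℝ)⌉₊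
  measurableSet_calib : ∀ J K, MeasurableSet {g | calib g J = K}

/-- A quantile estimation algorithm (for one quantile level): it turns a finite training sample
into a function of the context, jointly measurably in the sample and the context. -/
structure QuantileAlg (𝒮 : Type*) [MeasurableSpace 𝒮] where
  /-- the fitted function -/
  fit : List (𝒮 × ℝ) → 𝒮 → ℝ
  measurable_fit : ∀ l : ℕ,
    Measurable (fun p : (Fin l → 𝒮 × ℝ) × 𝒮 => fit (List.ofFn p.1) p.2)

section Algorithm

variable {𝒮 𝒜 : Type*} [MeasurableSpace 𝒮] [MeasurableSpace 𝒜] {ν : Kernel 𝒮 𝒜}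
  {γ : ℝ} {n : ℕ} {𝒢 : Type*} [MeasurableSpace 𝒢]

/-- The calibration indices chosen on the data `x`, the uniform variables `v` and the splitting
randomness `g`. -/
def calibSet (πe πb : Policy ν) (σ : SplitRule γ n 𝒢)
    (x : Fin n → (𝒮 × 𝒜) × ℝ) (v : Fin n → ℝ) (g : 𝒢) : Finset (Fin n) :=
  σ.calib g (accepted πe πb x v)

/-- The training sample, in the order of the original indices. -/
def trainSample (πe πb : Policy ν) (σ : SplitRule γ n 𝒢)
    (x : Fin n → (𝒮 × 𝒜) × ℝ) (v : Fin n → ℝ) (g : 𝒢) : List (𝒮 × ℝ) :=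
  pairs x (accepted πe πb x v \ calibSet πe πb σ x v g)

/-- The score `τ_i` of the observation with index `i`, from the quantile functions fitted on the
training sample. -/
def tau (πe πb : Policy ν) (σ : SplitRule γ n 𝒢) (qlo qup : QuantileAlg 𝒮)
    (x : Fin n → (𝒮 × 𝒜) × ℝ) (v : Fin n → ℝ) (g : 𝒢) (i : Fin n) : ℝ :=
  score (qlo.fit (trainSample πe πb σ x v g)) (qup.fit (trainSample πe πb σ x v g))
    (contextReward (x i))

/-- The prediction interval returned by the algorithm, as a function of the test context. -/
def predictionInterval (πe πb : Policy ν) (σ : SplitRule γ n 𝒢) (qlo qup : QuantileAlg 𝒮)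
    (ε δ : ℝ) (x : Fin n → (𝒮 × 𝒜) × ℝ) (v : Fin n → ℝ) (g : 𝒢) : 𝒮 → Set ℝ :=
  interval (qlo.fit (trainSample πe πb σ x v g)) (qup.fit (trainSample πe πb σ x v g))
    (threshold ε δ ((calibSet πe πb σ x v g).val.map (tau πe πb σ qlo qup x v g)))

end Algorithm

/-- `m₁ = max (log_{1-ε} δ) (log δ / (-2 Δ²))`. -/
def mOne (ε Δ δ : ℝ) : ℝ :=
  max (Real.logb (1 - ε) δ) (Real.log δ / (-2 * Δ ^ 2))

/-- The constant of the bound. -/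
def boundConst (B γ ε Δ δ : ℝ) : ℝ :=
  7 * B / √(γ * (ε - Δ) * (1 - ε + Δ))
    + (√(-2 * Real.log δ) + 1) * B / (2 * Δ * √γ)
    + (1 - δ) * (√((⌊mOne ε Δ δ / γ⌋₊ : ℝ) * B) + B / 2)

end PACOPP

end

noncomputable section

namespace PACOPP

/-! Rejection sampling accepts each index independently with probability `1 / B`, and the accepted
context-reward pairs are i.i.d. from the target law `Q` (`map_restrict_acceptRegion`). Freeze the
accepted set `J` and the calibration set `K`, of size `M`. The fitted score then depends on the
training pairs only, so the calibration pairs are independent of it. If `M ≥ 2`, the absence of ties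
forces the score to have no atoms under `Q`. The tail probabilities of the calibration scores are
then uniform, and the number of them that are at most `c` is `Bin(M, c)` (`pi_real_card_tail_le`).
For `k ≥ 0` the miscoverage is the tail probability at the `(k + 1)`-th largest score, so it is at
most `c` exactly when at least `k + 1` of these values are (`miscoverage_interval_le_iff`). Hence
the target range has conditional probability at least the difference of the binomial distribution
functions at `k` with parameters `ε - Δ` and `ε`.

The choice of `k` makes the subtracted term at most `δ`. Its maximality and Hoeffding's inequality
keep `k` from falling far below `M * ε`, so the other term misses `1` by at most a multiple of `1 /
√M` (`le_binCDF_sub_binCDF_cutoff`).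

No concentration of the number `N` of accepted observations is needed: `1 / √N` is at most `(n + 1)
/ (N + 1) / √n`, and `(n + 1) / (N + 1)` has mean at most `B`. The total loss is below the first two
terms of the constant (`lossCoeff_mul_lt_boundConst`). Conditioning is done throughout with
unnormalized restrictions of measures. -/

/-! ### Binomial distribution functions and Hoeffding bounds. -/

/-- The probability mass function of the binomial distribution. -/
def binPMF (M : ℕ) (p : ℝ) (i : ℕ) : ℝ := (M.choose i : ℝ) * p ^ i * (1 - p) ^ (M - i)

lemma binPMF_nonneg {M : ℕ} {p : ℝ} (h0 : 0 ≤ p) (h1 : p ≤ 1) (i : ℕ) : 0 ≤ binPMF M p i := by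
  have : 0 ≤ 1 - p := by linarith
  unfold binPMF; positivity

lemma binCDF_eq_sum_binPMF (M : ℕ) (p : ℝ) (k : ℤ) :
    binCDF M p k = ∑ i ∈ (Finset.range (M + 1)).filter (fun i : ℕ => (i : ℤ) ≤ k), binPMF M p i :=
  rfl

lemma sum_binPMF (M : ℕ) (p : ℝ) : ∑ i ∈ Finset.range (M + 1), binPMF M p i = 1 := by
  have h := add_pow p (1 - p) M
  rw [show p + (1 - p) = 1 by ring, one_pow] at h
  rw [h]
  exact Finset.sum_congr rfl fun i _ => by unfold binPMF; ring

lemma binCDF_self (M : ℕ) (p : ℝ) : binCDF M p M = 1 := by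
  rw [binCDF_eq_sum_binPMF, Finset.filter_true_of_mem, sum_binPMF]
  intro i hi
  have := Finset.mem_range.1 hi
  omega

lemma binCDF_of_neg (M : ℕ) (p : ℝ) {k : ℤ} (hk : k < 0) : binCDF M p k = 0 := by
  rw [binCDF_eq_sum_binPMF, Finset.filter_false_of_mem, Finset.sum_empty]
  intro i _
  omega

lemma binCDF_nonneg {M : ℕ} {p : ℝ} (h0 : 0 ≤ p) (h1 : p ≤ 1) (k : ℤ) : 0 ≤ binCDF M p k :=
  Finset.sum_nonneg fun i _ => binPMF_nonneg h0 h1 i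

lemma one_sub_binCDF (M : ℕ) (p : ℝ) (k : ℤ) :
    1 - binCDF M p k =
      ∑ i ∈ (Finset.range (M + 1)).filter (fun i : ℕ => ¬ (i : ℤ) ≤ k), binPMF M p i := by
  rw [← sum_binPMF M p, binCDF_eq_sum_binPMF,
    ← Finset.sum_filter_add_sum_filter_not (Finset.range (M + 1)) (fun i : ℕ => (i : ℤ) ≤ k)]
  ring

/-- Hoeffding's lemma for a Bernoulli variable. -/
lemma bernoulli_mgf_le {p : ℝ} (h0 : 0 ≤ p) (h1 : p ≤ 1) (t : ℝ) :
    1 - p + p * Real.exp t ≤ Real.exp (p * t + t ^ 2 / 8) := by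
  set μ : Measure ℝ :=
    ENNReal.ofReal (1 - p) • Measure.dirac 0 + ENNReal.ofReal p • Measure.dirac 1 with hμ
  have hint : ∀ f : ℝ → ℝ, ∫ x, f x ∂μ = (1 - p) * f 0 + p * f 1 := by
    intro f
    rw [hμ, integral_add_measure, integral_smul_measure, integral_smul_measure, integral_dirac,
      integral_dirac, ENNReal.toReal_ofReal (by linarith), ENNReal.toReal_ofReal h0]
    · simp
    · exact (integrable_dirac (by simp)).smul_measure (by simp)
    · exact (integrable_dirac (by simp)).smul_measure (by simp)
  have : IsProbabilityMeasure μ := ⟨by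
    simp only [hμ, Measure.coe_add, Measure.coe_smul, Pi.add_apply, Pi.smul_apply, measure_univ,
      smul_eq_mul, mul_one]
    rw [← ENNReal.ofReal_add (by linarith) h0]
    simp⟩
  have hmem : ∀ᵐ x ∂μ, x ∈ Set.Icc (0 : ℝ) 1 := by
    rw [hμ, ae_add_measure_iff]
    constructor
    · exact Measure.ae_smul_measure ((ae_dirac_iff (p := fun x => x ∈ Set.Icc (0 : ℝ) 1) measurableSet_Icc).2 (by simp)) _
    · exact Measure.ae_smul_measure ((ae_dirac_iff (p := fun x => x ∈ Set.Icc (0 : ℝ) 1) measurableSet_Icc).2 (by simp)) _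
  have h := (hasSubgaussianMGF_of_mem_Icc (X := fun x : ℝ => x) (μ := μ) aemeasurable_id hmem).mgf_le t
  simp only [mgf, hint] at h
  have hc : (((‖(1 : ℝ) - 0‖₊ / 2) ^ 2 : ℝ≥0) : ℝ) * t ^ 2 / 2 = t ^ 2 / 8 := by
    simp; ring
  rw [hc] at h
  have e0 : Real.exp (t * (0 - ((1 - p) * 0 + p * 1))) = Real.exp (-(p * t)) := by ring_nf
  have e1 : Real.exp (t * (1 - ((1 - p) * 0 + p * 1))) = Real.exp (-(p * t)) * Real.exp t := by
    rw [← Real.exp_add]; ring_nf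
  rw [e0, e1] at h
  calc 1 - p + p * Real.exp t
      = Real.exp (p * t) *
        ((1 - p) * Real.exp (-(p * t)) + p * (Real.exp (-(p * t)) * Real.exp t)) := by
        rw [Real.exp_neg]; field_simp
    _ ≤ Real.exp (p * t) * Real.exp (t ^ 2 / 8) := by gcongr
    _ = _ := by rw [← Real.exp_add]

/-- Chernoff's bound for the binomial distribution. -/
lemma sum_binPMF_le_exp {M : ℕ} {p : ℝ} (h0 : 0 ≤ p) (h1 : p ≤ 1) (t a : ℝ) {S : Finset ℕ}
    (hS : S ⊆ Finset.range (M + 1)) (ha : ∀ i ∈ S, a ≤ t * (i - M * p)) :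
    ∑ i ∈ S, binPMF M p i ≤ Real.exp (-a + M * t ^ 2 / 8) := by
  have hq : 0 ≤ 1 - p := by linarith
  calc ∑ i ∈ S, binPMF M p i
      ≤ ∑ i ∈ S, binPMF M p i * Real.exp (t * (i - M * p) - a) := by
        refine Finset.sum_le_sum fun i hi => le_mul_of_one_le_right (binPMF_nonneg h0 h1 i) ?_
        exact Real.one_le_exp (by linarith [ha i hi])
    _ ≤ ∑ i ∈ Finset.range (M + 1), binPMF M p i * Real.exp (t * (i - M * p) - a) :=
        Finset.sum_le_sum_of_subset_of_nonneg hS fun i _ _ =>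
          mul_nonneg (binPMF_nonneg h0 h1 i) (Real.exp_nonneg _)
    _ = Real.exp (-a - t * (M * p)) * (p * Real.exp t + (1 - p)) ^ M := by
        rw [add_pow, Finset.mul_sum]
        refine Finset.sum_congr rfl fun i _ => ?_
        rw [show t * (i - M * p) - a = (-a - t * (M * p)) + i * t by ring, Real.exp_add,
          Real.exp_nat_mul, mul_pow, binPMF]
        ring
    _ ≤ Real.exp (-a - t * (M * p)) * (Real.exp (p * t + t ^ 2 / 8)) ^ M := by
        have := bernoulli_mgf_le h0 h1 t
        have h2 : 0 ≤ p * Real.exp t + (1 - p) := by positivity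
        gcongr
        linarith
    _ = _ := by
        rw [← Real.exp_nat_mul, ← Real.exp_add]; ring_nf

lemma cutoff_spec {M : ℕ} {ε δ : ℝ} (hδ0 : 0 ≤ δ) :
    -1 ≤ cutoff M ε δ ∧ cutoff M ε δ ≤ (M : ℤ) - 1 ∧ binCDF M ε (cutoff M ε δ) ≤ δ := by
  have hne : {k : ℤ | -1 ≤ k ∧ k ≤ (M : ℤ) - 1 ∧ binCDF M ε k ≤ δ}.Nonempty :=
    ⟨-1, le_rfl, by omega, by rw [binCDF_of_neg _ _ (by norm_num)]; exact hδ0⟩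
  exact Int.csSup_mem hne ⟨(M : ℤ) - 1, fun k hk => hk.2.1⟩

/-- Maximality of the cutoff, except when it equals `M - 1`: the next integer is then outside the
admissible range, but the distribution function is `1` there. -/
lemma lt_binCDF_cutoff_add_one {M : ℕ} {ε δ : ℝ} (hδ0 : 0 ≤ δ) (hδ1 : δ < 1) :
    δ < binCDF M ε (cutoff M ε δ + 1) := by
  obtain ⟨h1, h2, -⟩ := cutoff_spec (M := M) (ε := ε) hδ0
  by_contra! hcon
  rcases eq_or_lt_of_le h2 with h | h
  · rw [h, sub_add_cancel, binCDF_self] at hcon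
    linarith
  · have : cutoff M ε δ + 1 ≤ cutoff M ε δ :=
      le_csSup ⟨(M : ℤ) - 1, fun k hk => hk.2.1⟩ ⟨by omega, by omega, hcon⟩
    omega

/-- The probability, for a continuous score, that the miscoverage is between `ε - Δ` and `ε`. -/
lemma le_binCDF_sub_binCDF_cutoff {M : ℕ} (hM : 1 ≤ M) {ε δ Δ : ℝ} (hε : ε ∈ Set.Ioo (0 : ℝ) 1)
    (hδ : δ ∈ Set.Ioo (0 : ℝ) 1) (hΔ : Δ ∈ Set.Ioo (0 : ℝ) ε) :
    1 - δ - (√(-2 * Real.log δ) + 1) / (2 * Δ * √(M : ℝ)) ≤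
      binCDF M (ε - Δ) (cutoff M ε δ) - binCDF M ε (cutoff M ε δ) := by
  obtain ⟨hε0, hε1⟩ := hε
  obtain ⟨hδ0, hδ1⟩ := hδ
  obtain ⟨hΔ0, hΔε⟩ := hΔ
  obtain ⟨-, -, hk⟩ := cutoff_spec (M := M) (ε := ε) hδ0.le
  have hk' := lt_binCDF_cutoff_add_one (M := M) (ε := ε) hδ0.le hδ1
  set k := cutoff M ε δ
  set v := √(-2 * Real.log δ) with hv
  have hlog : Real.log δ < 0 := Real.log_neg hδ0 hδ1
  have hv2 : v ^ 2 = -2 * Real.log δ := Real.sq_sqrt (by linarith)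
  have hv0 : 0 ≤ v := Real.sqrt_nonneg _
  set s := √(M : ℝ) with hs
  have hM0 : (0 : ℝ) < M := by exact_mod_cast hM
  have hs2 : s ^ 2 = M := Real.sq_sqrt hM0.le
  have hs0 : 0 < s := Real.sqrt_pos.2 hM0
  have hp0 : 0 ≤ ε - Δ := by linarith
  have hp1 : ε - Δ ≤ 1 := by linarith
  -- the cutoff is not far below its mean
  have hlow : M * ε - s * (v / 2) < k + 1 := by
    by_contra! hcon
    set y : ℝ := M * ε - (k + 1) with hy
    have hy0 : s * (v / 2) ≤ y := by linarith
    have hy00 : 0 ≤ y := le_trans (by positivity) hy0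
    -- The slope `-(4 * y / M)` minimizes the Chernoff exponent for a deviation `y` and gives `-(2 *
    -- y ^ 2 / M)`.
    have hb := sum_binPMF_le_exp (M := M) hε0.le hε1.le (-(4 * y / M)) (4 * y ^ 2 / M)
      (Finset.filter_subset (fun i : ℕ => (i : ℤ) ≤ k + 1) (Finset.range (M + 1))) (by
        intro i hi
        have hi2 : (i : ℤ) ≤ k + 1 := (Finset.mem_filter.1 hi).2
        have hi3 : (i : ℝ) ≤ k + 1 := by exact_mod_cast hi2
        have : y ≤ M * ε - i := by linarith
        calc 4 * y ^ 2 / M = 4 * y / M * y := by ring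
          _ ≤ 4 * y / M * (M * ε - i) := by gcongr
          _ = _ := by ring)
    rw [← binCDF_eq_sum_binPMF] at hb
    have hexp : -(4 * y ^ 2 / M) + M * (-(4 * y / M)) ^ 2 / 8 = -(2 * y ^ 2 / M) := by
      field_simp; ring
    rw [hexp] at hb
    have h3 : Real.log δ < -(2 * y ^ 2 / M) := (Real.log_lt_iff_lt_exp hδ0).2 (hk'.trans_le hb)
    have h4 : (s * (v / 2)) ^ 2 ≤ y ^ 2 := by gcongr
    have h5 : 2 * y ^ 2 < M * (-Real.log δ) := by
      have : 2 * y ^ 2 / M < -Real.log δ := by linarith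
      rwa [div_lt_iff₀ hM0, mul_comm (-Real.log δ)] at this
    nlinarith
  set z := s * Δ - v / 2 with hz
  have hden : 0 < 2 * Δ * s := by positivity
  -- `√M * z` bounds from below the gap between `k + 1` and the mean `M * (ε - Δ)`. If `z ≤ 0`, the
  -- allowed loss is already at least `1`.
  rcases le_or_gt z 0 with hz0 | hz0
  · have h1 : 1 ≤ (v + 1) / (2 * Δ * s) := by
      rw [le_div_iff₀ hden]; nlinarith
    have := binCDF_nonneg (M := M) hp0 hp1 k
    linarith
  · have hb := sum_binPMF_le_exp (M := M) hp0 hp1 (4 * z / s) (4 * z ^ 2)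
      (Finset.filter_subset (fun i : ℕ => ¬ (i : ℤ) ≤ k) (Finset.range (M + 1))) (by
        intro i hi
        have hi2 : ¬ (i : ℤ) ≤ k := (Finset.mem_filter.1 hi).2
        have hi3 : k + 1 ≤ (i : ℤ) := by omega
        have hi4 : (k : ℝ) + 1 ≤ i := by exact_mod_cast hi3
        have : s * z ≤ i - M * (ε - Δ) := by rw [hz, ← hs2]; rw [← hs2] at hlow; nlinarith
        calc 4 * z ^ 2 = 4 * z / s * (s * z) := by field_simp
          _ ≤ 4 * z / s * (i - M * (ε - Δ)) := by gcongr)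
    rw [← one_sub_binCDF] at hb
    have hexp : -(4 * z ^ 2) + M * (4 * z / s) ^ 2 / 8 = -(2 * z ^ 2) := by
      rw [← hs2]; field_simp; ring
    rw [hexp] at hb
    have h1 : Real.exp (-(2 * z ^ 2)) ≤ (v + 1) / (2 * Δ * s) := by
      have h2 : 2 * z ^ 2 + 1 ≤ Real.exp (2 * z ^ 2) := Real.add_one_le_exp _
      rw [Real.exp_neg, inv_le_comm₀ (Real.exp_pos _) (by positivity), inv_div]
      refine le_trans ?_ h2
      rw [div_le_iff₀ (by positivity)]
      have : 2 * Δ * s = 2 * z + v := by rw [hz]; ring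
      rw [this]
      -- The claim reduces to `0 ≤ 2 * v * z ^ 2 + 2 * (z - 1 / 2) ^ 2 + 1 / 2`.
      nlinarith [mul_nonneg hv0 (sq_nonneg z), sq_nonneg (z - 1 / 2)]
    linarith

/-- The mean of `1 / (N + 1)` for a binomial `N`. -/
lemma sum_binPMF_div_le (n : ℕ) {q : ℝ} (h0 : 0 < q) (h1 : q ≤ 1) :
    ∑ i ∈ Finset.range (n + 1), binPMF n q i * ((n + 1) / (i + 1)) ≤ 1 / q := by
  rw [le_div_iff₀ h0, Finset.sum_mul]
  -- Size biasing: each term becomes the `Bin(n + 1, q)` mass of `i + 1`, so only the mass at `0` is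
  -- missing from the total.
  calc ∑ i ∈ Finset.range (n + 1), binPMF n q i * ((n + 1) / (i + 1)) * q
      = ∑ i ∈ Finset.range (n + 1), binPMF (n + 1) q (i + 1) := by
        refine Finset.sum_congr rfl fun i _ => ?_
        have h : ((n : ℝ) + 1) * n.choose i = (n + 1).choose (i + 1) * (i + 1) := by
          exact_mod_cast Nat.add_one_mul_choose_eq n i
        have hi : (i : ℝ) + 1 ≠ 0 := by positivity
        rw [binPMF, binPMF, Nat.add_sub_add_right, pow_succ]
        rw [show ((n + 1).choose (i + 1) : ℝ) = (n + 1) * n.choose i / (i + 1) by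
          rw [h]; field_simp]
        ring
    _ ≤ ∑ i ∈ Finset.range (n + 1 + 1), binPMF (n + 1) q i := by
        rw [Finset.sum_range_succ' _ (n + 1)]
        linarith [binPMF_nonneg (M := n + 1) h0.le h1 0]
    _ = 1 := sum_binPMF _ _

/-- A consequence of the monotonicity of `x + 1 / x` on `[1, ∞)`. -/
lemma one_div_sqrt_le {n N : ℕ} (hN : 1 ≤ N) (hNn : N ≤ n) :
    1 / √(N : ℝ) ≤ (n + 1) / (N + 1) / √(n : ℝ) := by
  have hN' : (1 : ℝ) ≤ N := by exact_mod_cast hN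
  have hn' : (N : ℝ) ≤ n := by exact_mod_cast hNn
  have ha : 1 ≤ √(N : ℝ) := Real.one_le_sqrt.2 hN'
  have hab : √(N : ℝ) ≤ √(n : ℝ) := Real.sqrt_le_sqrt hn'
  have ha2 : √(N : ℝ) ^ 2 = N := Real.sq_sqrt (by linarith)
  have hb2 : √(n : ℝ) ^ 2 = n := Real.sq_sqrt (by linarith)
  set a := √(N : ℝ)
  set b := √(n : ℝ)
  rw [div_div, div_le_div_iff₀ (by linarith) (mul_pos (by positivity) (by linarith)), ← ha2, ← hb2]
  nlinarith [mul_nonneg (sub_nonneg.2 hab) (by nlinarith : 0 ≤ a * b - 1)]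

/-! ### Order statistics and miscoverage. -/

open Classical in
/-- Comparison of the `(k + 1)`-th largest element with a level set of an antitone function. -/
lemma countP_orderStat (t : Multiset ℝ) {k : ℤ} (h0 : 0 ≤ k) (hk : k ≤ (t.card : ℤ) - 1) :
    ∃ y : ℝ, orderStat t ((t.card : ℤ) - k).toNat = (y : EReal) ∧
      ∀ (G : ℝ → ℝ), Antitone G → ∀ c : ℝ,
        (G y ≤ c ↔ k + 1 ≤ (t.countP (fun x => G x ≤ c) : ℤ)) := by
  set l := t.sort (· ≤ ·) with hl
  have hlen : l.length = t.card := Multiset.length_sort _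
  have hlt : (l : Multiset ℝ) = t := Multiset.sort_eq _ _
  have hsort : l.Pairwise (· ≤ ·) := Multiset.pairwise_sort _ _
  -- Zero-based position of the order statistic: exactly `k + 1` entries of the sorted list stand at
  -- `j` or later.
  set j := ((t.card : ℤ) - k).toNat - 1 with hj
  have hjl : j < l.length := by omega
  have hjk : ((l.length - j : ℕ) : ℤ) = k + 1 := by omega
  refine ⟨l[j], ?_, fun G hG c => ?_⟩
  · rw [orderStat, ← hl, ← hj, List.getD_eq_getElem _ _ (by simpa using hjl)]
    simp
  have hmono : ∀ a b (ha : a < l.length) (hb : b < l.length), a ≤ b → l[a] ≤ l[b] := by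
    intro a b ha hb hab
    exact hsort.sortedLE.getElem_le_getElem_of_le hab
  have hcount : t.countP (fun x => G x ≤ c) = l.countP (fun x => G x ≤ c) := by
    rw [← hlt, Multiset.coe_countP]
  rw [hcount, ← hjk, Nat.cast_le]
  constructor
  · intro h
    calc l.length - j = (l.drop j).length := by simp
      _ = (l.drop j).countP (fun x => G x ≤ c) := by
        symm
        rw [List.countP_eq_length]
        intro x hx
        obtain ⟨i, hi, rfl⟩ := List.mem_iff_getElem.1 hx
        rw [List.getElem_drop]
        simp only [List.length_drop] at hi
        exact decide_eq_true ((hG (hmono j (j + i) hjl (by omega) (by omega))).trans h)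
      _ ≤ l.countP (fun x => G x ≤ c) := (List.drop_sublist j l).countP_le
  · intro h
    by_contra! hcon
    have hz : (l.take (j + 1)).countP (fun x => G x ≤ c) = 0 := by
      rw [List.countP_eq_zero]
      intro x hx
      obtain ⟨i, hi, rfl⟩ := List.mem_iff_getElem.1 hx
      rw [List.getElem_take]
      simp only [List.length_take] at hi
      have := hG (hmono i j (by omega) hjl (by omega))
      simp only [decide_eq_true_eq, not_le]
      linarith
    have h2 : l.countP (fun x => G x ≤ c) ≤ l.length - (j + 1) := by
      conv_lhs => rw [← List.take_append_drop (j + 1) l, List.countP_append, hz, zero_add]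
      exact List.countP_le_length.trans (by simp)
    omega

/-- Leaving the widened interval below or above means that the corresponding term of the maximum
exceeds `τ`. Miscoverage thus becomes a tail probability of the score. -/
lemma notMem_interval_iff {𝒮 : Type*} (qlo qup : 𝒮 → ℝ) (τ : ℝ) (z : 𝒮 × ℝ) :
    z.2 ∉ interval qlo qup (τ : EReal) z.1 ↔ τ < score qlo qup z := by
  have h1 : ((qlo z.1 : EReal) - (τ : EReal) ≤ (z.2 : EReal)) ↔ qlo z.1 - τ ≤ z.2 := by
    rw [← EReal.coe_sub, EReal.coe_le_coe_iff]
  have h2 : ((z.2 : EReal) ≤ (qup z.1 : EReal) + (τ : EReal)) ↔ z.2 ≤ qup z.1 + τ := by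
    rw [← EReal.coe_add, EReal.coe_le_coe_iff]
  simp only [interval, Set.mem_ofPred_eq, h1, h2, score, lt_max_iff, not_and_or, not_le]
  constructor <;> rintro (h | h)
  · left; linarith
  · right; linarith
  · left; linarith
  · right; linarith

open Classical in
/-- The miscoverage of the calibrated interval is at most `c` iff at least `k + 1` of the
calibration scores have a tail probability at most `c`. -/
lemma miscoverage_interval_le_iff {𝒮 ι : Type*} [MeasurableSpace 𝒮] (Q : Measure (𝒮 × ℝ))
    [IsFiniteMeasure Q] (qlo qup : 𝒮 → ℝ) (ε δ : ℝ) (K : Finset ι) (y : ι → ℝ)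
    (h0 : 0 ≤ cutoff K.card ε δ) (hk : cutoff K.card ε δ ≤ (K.card : ℤ) - 1) (c : ℝ) :
    miscoverage Q (interval qlo qup (threshold ε δ (K.val.map y))) ≤ c ↔
      cutoff K.card ε δ + 1 ≤
        ((K.filter (fun i => Q.real {z | y i < score qlo qup z} ≤ c)).card : ℤ) := by
  have hcard : (K.val.map y).card = K.card := by simp
  obtain ⟨τ, hτ, h⟩ := countP_orderStat (K.val.map y) (k := cutoff K.card ε δ) h0
    (by rw [hcard]; exact hk)
  have hG : Antitone (fun t : ℝ => Q.real {z | t < score qlo qup z}) := fun a b hab =>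
    measureReal_mono fun z hz => lt_of_le_of_lt hab hz
  rw [hcard] at hτ
  rw [threshold, hcard, hτ, miscoverage]
  have hset : {z : 𝒮 × ℝ | z.2 ∉ interval qlo qup (τ : EReal) z.1} =
      {z | τ < score qlo qup z} := by
    ext z; exact notMem_interval_iff _ _ _ _
  rw [hset]
  refine (h _ hG c).trans ?_
  rw [Multiset.countP_map]
  rfl

/-! ### Counts under product measures and the probability integral transform. -/

open Classical in
lemma measurableSet_card_filter_le {α ι : Type*} [MeasurableSpace α] (s : Finset ι)
    {A : ι → Set α} (hA : ∀ i, MeasurableSet (A i)) (k : ℤ) :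
    MeasurableSet {x | ((s.filter (fun i => x ∈ A i)).card : ℤ) ≤ k} := by
  have hm : Measurable (fun x => ((s.filter (fun i => x ∈ A i)).card : ℤ)) := by
    simp_rw [Finset.card_filter]
    push_cast
    exact Finset.measurable_fun_sum s fun i _ =>
      Measurable.ite (hA i) measurable_const measurable_const
  exact hm measurableSet_Iic

open Classical in
/-- The number of coordinates in a set is binomial under a power of a finite measure. -/
lemma pi_real_card_filter_le {ι Z : Type*} [Fintype ι] [MeasurableSpace Z] (ρ : Measure Z)
    [IsFiniteMeasure ρ] {A : Set Z} (hA : MeasurableSet A) (k : ℤ) :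
    (Measure.pi (fun _ : ι => ρ)).real
        {y | ((Finset.univ.filter (fun i => y i ∈ A)).card : ℤ) ≤ k} =
      ∑ m ∈ (Finset.range (Fintype.card ι + 1)).filter (fun m : ℕ => (m : ℤ) ≤ k),
        ((Fintype.card ι).choose m : ℝ) * ρ.real A ^ m * ρ.real Aᶜ ^ (Fintype.card ι - m) := by
  -- Fixing which coordinates lie in `A` cuts the event into disjoint boxes, whose mass depends only
  -- on the number of such coordinates.
  set box : Finset ι → Set (ι → Z) :=
    fun T => Set.univ.pi (fun i => if i ∈ T then A else Aᶜ) with hbox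
  have hmem : ∀ T y, y ∈ box T ↔ Finset.univ.filter (fun i => y i ∈ A) = T := by
    intro T y
    simp only [hbox, Set.mem_pi, Set.mem_univ, true_implies, Finset.ext_iff, Finset.mem_filter,
      Finset.mem_univ, true_and]
    refine forall_congr' fun i => ?_
    by_cases hi : i ∈ T <;> simp [hi]
  have hunion : {y : ι → Z | ((Finset.univ.filter (fun i => y i ∈ A)).card : ℤ) ≤ k} =
      ⋃ T ∈ (Finset.univ : Finset (Finset ι)).filter (fun T => (T.card : ℤ) ≤ k), box T := by
    ext y
    simp only [Set.mem_iUnion, hmem]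
    simp
  have hbm : ∀ T, MeasurableSet (box T) := fun T =>
    MeasurableSet.univ_pi fun i => by split_ifs <;> [exact hA; exact hA.compl]
  have hreal : ∀ T, (Measure.pi (fun _ : ι => ρ)).real (box T) =
      ρ.real A ^ T.card * ρ.real Aᶜ ^ (Fintype.card ι - T.card) := by
    intro T
    rw [Measure.real, hbox, Measure.pi_pi, ENNReal.toReal_prod]
    have h1 : ∀ i, (ρ (if i ∈ T then A else Aᶜ)).toReal =
        if i ∈ T then ρ.real A else ρ.real Aᶜ := fun i => by split_ifs <;> rfl
    simp_rw [h1]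
    rw [Finset.prod_ite]
    simp [Finset.filter_not, Finset.card_sdiff]
  rw [hunion, measureReal_biUnion_finset]
  · simp_rw [hreal]
    rw [Finset.sum_filter, Finset.sum_filter, ← Finset.powerset_univ]
    rw [Finset.sum_powerset_apply_card (fun m : ℕ => if (m : ℤ) ≤ k then
      ρ.real A ^ m * ρ.real Aᶜ ^ (Fintype.card ι - m) else 0)]
    rw [Finset.card_univ]
    refine Finset.sum_congr rfl fun m _ => ?_
    split_ifs
    · rw [nsmul_eq_mul]; ring
    · simp
  · intro T _ T' _ hne
    rw [Function.onFun, Set.disjoint_left]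
    intro y hy hy'
    exact hne (((hmem T y).1 hy).symm.trans ((hmem T' y).1 hy'))
  · exact fun T _ => hbm T

-- The total mass `c` factors out of every coordinate. The case needed is `c = 1 / B`, the
-- unnormalized law of an accepted pair.
open Classical in
lemma pi_smul_real_card_filter_le {ι Z : Type*} [Fintype ι] [MeasurableSpace Z] (Q : Measure Z)
    [IsProbabilityMeasure Q] (c : ℝ≥0) {A : Set Z} (hA : MeasurableSet A) (k : ℤ) :
    (Measure.pi (fun _ : ι => c • Q)).real
        {y | ((Finset.univ.filter (fun i => y i ∈ A)).card : ℤ) ≤ k} =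
      (c : ℝ) ^ Fintype.card ι * binCDF (Fintype.card ι) (Q.real A) k := by
  rw [pi_real_card_filter_le _ hA, binCDF, Finset.mul_sum]
  refine Finset.sum_congr rfl fun m hm => ?_
  have hm : m ≤ Fintype.card ι := by
    have := Finset.mem_range.1 (Finset.mem_filter.1 hm).1
    omega
  have hc : ∀ S, (c • Q).real S = c * Q.real S := fun S => by
    rw [measureReal_nnreal_smul_apply]
  rw [hc, hc, measureReal_compl hA, probReal_univ, mul_pow, mul_pow]
  conv_rhs => rw [← Nat.add_sub_cancel' hm, pow_add]
  simp only [Nat.add_sub_cancel' hm]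
  ring

/-- The probability integral transform, for the tail function of a score without atoms. -/
lemma real_tail_le {Z : Type*} [MeasurableSpace Z] (Q : Measure Z) [IsProbabilityMeasure Q]
    {s : Z → ℝ} (hs : Measurable s) (h0 : ∀ a, Q {z | s z = a} = 0) {c : ℝ}
    (hc : c ∈ Set.Ioo (0 : ℝ) 1) :
    Q.real {z | Q.real {z' | s z < s z'} ≤ c} = c := by
  set μ := Q.map s with hμ
  have : IsProbabilityMeasure μ := Measure.isProbabilityMeasure_map hs.aemeasurable
  have hcont : Continuous (cdf μ) := by
    rw [continuous_iff_continuousAt]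
    intro x
    rw [(monotone_cdf μ).continuousAt_iff_leftLim_eq_rightLim, StieltjesFunction.rightLim_eq]
    have h1 := (cdf μ).measure_singleton x
    rw [measure_cdf, hμ, Measure.map_apply hs (measurableSet_singleton x)] at h1
    rw [show s ⁻¹' {x} = {z | s z = x} from rfl, h0 x] at h1
    have h2 := ENNReal.ofReal_eq_zero.1 h1.symm
    have h3 := (monotone_cdf μ).leftLim_le (le_refl x)
    linarith
  have hlt : ∀ y, Q.real {z | s z < y} = cdf μ y := by
    intro y
    rw [cdf_eq_real, hμ, map_measureReal_apply hs measurableSet_Iic]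
    refine measureReal_congr ?_
    have : ∀ᵐ z ∂Q, s z ≠ y := by rw [ae_iff]; simpa using h0 y
    filter_upwards [this] with z hz
    refine propext ⟨fun h => le_of_lt h, fun h => lt_of_le_of_ne h hz⟩
  have hG : ∀ y, Q.real {z' | y < s z'} = 1 - cdf μ y := by
    intro y
    rw [cdf_eq_real, hμ, map_measureReal_apply hs measurableSet_Iic,
      ← probReal_compl_eq_one_sub (hs measurableSet_Iic)]
    congr 1
    ext z
    simp
  simp_rw [hG]
  obtain ⟨a, ha⟩ := ((tendsto_cdf_atBot μ).eventually
    (gt_mem_nhds (show (0 : ℝ) < 1 - c by linarith [hc.2]))).exists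
  obtain ⟨b, hb⟩ := ((tendsto_cdf_atTop μ).eventually
    (lt_mem_nhds (show 1 - c < (1 : ℝ) by linarith [hc.1]))).exists
  set S := {y : ℝ | 1 - c ≤ cdf μ y} with hS
  have hSc : IsClosed S := isClosed_le continuous_const hcont
  have hSb : BddBelow S := ⟨a, fun y hy => by
    by_contra! hya
    have h1 := monotone_cdf μ hya.le
    have h2 : 1 - c ≤ cdf μ y := hy
    linarith⟩
  have htS : sInf S ∈ S := hSc.csInf_mem ⟨b, hb.le⟩ hSb
  set t := sInf S
  have hSt : ∀ y, 1 - c ≤ cdf μ y ↔ t ≤ y := fun y =>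
    ⟨fun h => csInf_le hSb h, fun h => le_trans htS (monotone_cdf μ h)⟩
  -- Continuity excludes an overshoot at the quantile: otherwise the level `1 - c` would be attained
  -- strictly to the left of `t`.
  have hteq : cdf μ t = 1 - c := by
    refine le_antisymm ?_ htS
    by_contra! hcon
    obtain ⟨y, hy1, hy2⟩ : ∃ y, cdf μ y = 1 - c ∧ y ≤ t := by
      have hat : a ≤ t := by
        by_contra! h
        have := monotone_cdf μ h.le
        linarith
      obtain ⟨y, hy, hyc⟩ := intermediate_value_Icc hat hcont.continuousOn ⟨ha.le, hcon.le⟩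
      exact ⟨y, hyc, hy.2⟩
    have : t ≤ y := (hSt y).1 hy1.ge
    have : y = t := le_antisymm hy2 this
    rw [this] at hy1
    linarith
  have hset : {z | 1 - cdf μ (s z) ≤ c} = {z | s z < t}ᶜ := by
    ext z
    simp only [Set.mem_ofPred_eq, Set.mem_compl_iff, not_lt, ← hSt]
    constructor <;> intro h <;> linarith
  have hm : MeasurableSet {z | s z < t} := hs measurableSet_Iio
  rw [hset, probReal_compl_eq_one_sub hm, hlt, hteq]
  ring

lemma measurable_real_tail {α Z : Type*} [MeasurableSpace α] [MeasurableSpace Z] (Q : Measure Z)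
    [IsProbabilityMeasure Q] {u : α → ℝ} {s : α → Z → ℝ} (hu : Measurable u)
    (hs : Measurable (Function.uncurry s)) :
    Measurable (fun x => Q.real {z | u x < s x z}) := by
  have : MeasurableSet {p : α × Z | u p.1 < Function.uncurry s p} :=
    measurableSet_lt (hu.comp measurable_fst) hs
  exact (measurable_measure_prodMk_left this).ennreal_toReal

open Classical in
/-- Under a product measure whose coordinates in `K` are multiples of `Q`, if the score function
depends only on the coordinates outside `K` and there are no ties among the scores of the
coordinates in `K`, then the number of coordinates in `K` with a tail probability at most `c` is
binomial. -/
lemma pi_real_card_tail_le {ι Z : Type*} [Fintype ι] [MeasurableSpace Z] (Q : Measure Z)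
    [IsProbabilityMeasure Q] (q : ℝ≥0) (hq : q ≠ 0) (ρ : ι → Measure Z)
    [∀ i, IsFiniteMeasure (ρ i)] (K : Finset ι) (hK : 2 ≤ K.card) (hρ : ∀ i ∈ K, ρ i = q • Q)
    (sc : (ι → Z) → Z → ℝ) (hsc : Measurable (Function.uncurry sc))
    (hdep : ∀ x x' : ι → Z, (∀ i ∉ K, x i = x' i) → sc x = sc x')
    (hties : ∀ᵐ x ∂Measure.pi ρ, Set.InjOn (fun i => sc x (x i)) K)
    {c : ℝ} (hc : c ∈ Set.Ioo (0 : ℝ) 1) (k : ℤ) :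
    (Measure.pi ρ).real
        {x | ((K.filter (fun i => Q.real {z | sc x (x i) < sc x z} ≤ c)).card : ℤ) ≤ k} =
      (∏ i, (ρ i).real Set.univ) * binCDF K.card c k := by
  have : Nonempty Z := Q.nonempty_of_neZero
  obtain ⟨z0⟩ := this
  set e := MeasurableEquiv.piEquivPiSubtypeProd (fun _ : ι => Z) (fun i => i ∈ K) with he
  have hmp : MeasurePreserving e (Measure.pi ρ)
      ((Measure.pi fun i : {i // i ∈ K} => ρ i).prod (Measure.pi fun i : {i // ¬ i ∈ K} => ρ i)) := by
    convert! measurePreserving_piEquivPiSubtypeProd ρ (fun i => i ∈ K)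
  have hmp' := hmp.symm
  have hρK : (Measure.pi fun i : {i // i ∈ K} => ρ i) = Measure.pi fun _ : {i // i ∈ K} => q • Q := by
    congr 1
    ext1 i
    exact hρ i i.2
  set S := {x : ι → Z |
    ((K.filter (fun i => Q.real {z | sc x (x i) < sc x z} ≤ c)).card : ℤ) ≤ k} with hS
  have hSm : MeasurableSet S := by
    refine measurableSet_card_filter_le K
      (A := fun i => {x : ι → Z | Q.real {z | sc x (x i) < sc x z} ≤ c}) (fun i => ?_) k
    refine measurableSet_le (measurable_real_tail Q ?_ hsc) measurable_const
    exact hsc.comp (measurable_id.prodMk (measurable_pi_apply i))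
  -- The score ignores the coordinates in `K`, so they may be filled with the arbitrary point `z0`.
  set scw : ((i : {i // ¬ i ∈ K}) → Z) → Z → ℝ := fun w => sc (e.symm (fun _ => z0, w)) with hscw
  have hscwm : ∀ w, Measurable (scw w) := fun w => hsc.comp measurable_prodMk_left
  have hin : ∀ y w (i : {i // i ∈ K}), e.symm (y, w) i = y i := by
    intro y w i
    rw [he]
    simp [MeasurableEquiv.piEquivPiSubtypeProd, Equiv.piEquivPiSubtypeProd]
  have hsceq : ∀ y w, sc (e.symm (y, w)) = scw w := by
    intro y w
    refine hdep _ _ fun i hi => ?_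
    rw [he]
    simp [MeasurableEquiv.piEquivPiSubtypeProd, Equiv.piEquivPiSubtypeProd, hi]
  -- By Fubini, almost every `w` has almost surely no ties. An atom at `a` would give positive mass
  -- to the box where all scores in `K` equal `a`, a tie since `K` has two elements.
  have hatom : ∀ᵐ w ∂(Measure.pi fun i : {i // ¬ i ∈ K} => ρ i), ∀ a, Q {z | scw w z = a} = 0 := by
    have h1 := hmp'.quasiMeasurePreserving.ae hties
    have h2 := (Measure.measurePreserving_swap (μ := Measure.pi fun i : {i // ¬ i ∈ K} => ρ i)
      (ν := Measure.pi fun i : {i // i ∈ K} => ρ i)).quasiMeasurePreserving.ae h1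
    have h3 := Measure.ae_ae_of_ae_prod h2
    filter_upwards [h3] with w hw a
    by_contra hne
    rw [hρK, ae_iff] at hw
    have hbox : (Measure.pi fun _ : {i // i ∈ K} => q • Q)
        (Set.univ.pi fun _ => {z | scw w z = a}) = 0 := by
      refine measure_mono_null ?_ hw
      intro y hy hinj
      obtain ⟨i, hi, j, hj, hij⟩ := Finset.one_lt_card.1 (show 1 < K.card by omega)
      refine hij (hinj hi hj ?_)
      simp only [Prod.swap_prod_mk, hsceq]
      have hyi := hy ⟨i, hi⟩ (Set.mem_univ _)
      have hyj := hy ⟨j, hj⟩ (Set.mem_univ _)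
      rw [hin y w ⟨i, hi⟩, hin y w ⟨j, hj⟩]
      exact hyi.trans hyj.symm
    rw [Measure.pi_pi, Finset.prod_eq_zero_iff] at hbox
    obtain ⟨i, -, hi⟩ := hbox
    rw [Measure.smul_apply] at hi
    rcases mul_eq_zero.1 hi with h | h
    · exact hq (by simpa using h)
    · exact hne h
  have hsec : ∀ᵐ w ∂(Measure.pi fun i : {i // ¬ i ∈ K} => ρ i),
      (Measure.pi fun i : {i // i ∈ K} => ρ i) ((fun y => (y, w)) ⁻¹' (e.symm ⁻¹' S)) =
        ENNReal.ofReal ((q : ℝ) ^ K.card * binCDF K.card c k) := by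
    filter_upwards [hatom] with w hw
    have hA : MeasurableSet {z | Q.real {z' | scw w z < scw w z'} ≤ c} :=
      measurableSet_le (measurable_real_tail Q (s := fun _ => scw w) (hscwm w)
        ((hscwm w).comp measurable_snd)) measurable_const
    have h1 := pi_smul_real_card_filter_le (ι := {i // i ∈ K}) Q q hA k
    rw [real_tail_le Q (hscwm w) hw hc, Fintype.card_coe] at h1
    rw [← h1, hρK, ofReal_measureReal]
    congr 1
    ext y
    simp only [hS, Set.mem_preimage, Set.mem_ofPred_eq, hsceq]
    have hcard : (K.filter (fun i =>
          Q.real {z | scw w (e.symm (y, w) i) < scw w z} ≤ c)).card =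
        (Finset.univ.filter (fun i : {i // i ∈ K} =>
          Q.real {z' | scw w (y i) < scw w z'} ≤ c)).card := by
      rw [Finset.card_filter, Finset.card_filter, ← Finset.sum_attach, Finset.univ_eq_attach]
      refine Finset.sum_congr rfl fun i _ => ?_
      rw [hin y w i]
    rw [hcard]
  have hmain : (Measure.pi ρ) S = ENNReal.ofReal ((q : ℝ) ^ K.card * binCDF K.card c k) *
      (Measure.pi fun i : {i // ¬ i ∈ K} => ρ i) Set.univ := by
    rw [← hmp'.measure_preimage hSm.nullMeasurableSet,
      Measure.prod_apply_symm (e.symm.measurable hSm), lintegral_congr_ae hsec, lintegral_const]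
  have hF := binCDF_nonneg (M := K.card) hc.1.le hc.2.le k
  rw [Measure.real, hmain, ENNReal.toReal_mul, ENNReal.toReal_ofReal (by positivity),
    Measure.pi_univ, ENNReal.toReal_prod]
  have hsplit : (∏ i, (ρ i).real Set.univ) =
      (∏ i : {i // i ∈ K}, (ρ i).real Set.univ) * ∏ i : {i // ¬ i ∈ K}, (ρ i).real Set.univ := by
    rw [← Fintype.prod_subtype_mul_prod_subtype (fun i => i ∈ K) (fun i => (ρ i).real Set.univ)]
    congr!
  have hprodK : ∏ i : {i // i ∈ K}, (ρ i).real Set.univ = (q : ℝ) ^ K.card := by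
    rw [Finset.prod_congr rfl (g := fun _ => (q : ℝ)) (fun i _ => ?_), Finset.prod_const,
      Finset.card_univ, Fintype.card_coe]
    rw [hρ i i.2, measureReal_nnreal_smul_apply, probReal_univ, mul_one]
  rw [hsplit, hprodK]
  simp only [Measure.real]
  ring

/-! ### Rejection sampling. -/

section Rejection

variable {𝒮 𝒜 : Type*} [MeasurableSpace 𝒮] [MeasurableSpace 𝒜] {ν : Kernel 𝒮 𝒜}

/-- The infimum is attained: where `π_b` is positive the ratio is below every admissible `b`, and
where `π_b` vanishes so does `π_e`. -/
lemma dens_le_ratioBound_mul {πe πb : Policy ν} (hB : (ratioBounds πe πb).Nonempty) (s : 𝒮)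
    (a : 𝒜) : πe.dens s a ≤ ratioBound πe πb * πb.dens s a := by
  rcases eq_or_ne (πb.dens s a) 0 with h | h
  · obtain ⟨b, hb⟩ := hB
    simpa [h] using hb s a
  · rw [← div_le_iff₀ (pos_iff_ne_zero.2 h)]
    refine le_csInf hB fun b hb => ?_
    rw [div_le_iff₀ (pos_iff_ne_zero.2 h)]
    exact hb s a

/-- Integrate the density bound over the actions: both densities have integral one. -/
lemma one_le_ratioBound {πe πb : Policy ν} (hB : (ratioBounds πe πb).Nonempty) [Nonempty 𝒮] :
    1 ≤ ratioBound πe πb := by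
  obtain ⟨s⟩ := ‹Nonempty 𝒮›
  have h : (1 : ℝ≥0∞) ≤ ratioBound πe πb := by
    calc (1 : ℝ≥0∞) = ∫⁻ a, (πe.dens s a : ℝ≥0∞) ∂(ν s) := (πe.lintegral_dens s).symm
      _ ≤ ∫⁻ a, (ratioBound πe πb : ℝ≥0∞) * (πb.dens s a : ℝ≥0∞) ∂(ν s) :=
        lintegral_mono fun a => by
          rw [← ENNReal.coe_mul]
          exact ENNReal.coe_le_coe.2 (dens_le_ratioBound_mul hB s a)
      _ = ratioBound πe πb := by
        rw [lintegral_const_mul' _ _ ENNReal.coe_ne_top, πb.lintegral_dens, mul_one]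
  exact_mod_cast h

/-- The convention `0 / 0 = 0` loses nothing, because `π_e` vanishes wherever `π_b` does. -/
lemma dens_mul_weight {πe πb : Policy ν} (hB : (ratioBounds πe πb).Nonempty) (s : 𝒮) (a : 𝒜) :
    πb.dens s a * weight πe πb s a = πe.dens s a := by
  rcases eq_or_ne (πb.dens s a) 0 with h | h
  · have := dens_le_ratioBound_mul hB s a
    rw [h, mul_zero] at this
    rw [h, zero_mul, le_antisymm this zero_le]
  · rw [weight, mul_div_cancel₀ _ h]

lemma weight_le_ratioBound {πe πb : Policy ν} (hB : (ratioBounds πe πb).Nonempty) (s : 𝒮)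
    (a : 𝒜) : weight πe πb s a ≤ ratioBound πe πb := by
  rcases eq_or_ne (πb.dens s a) 0 with h | h
  · simp [weight, h]
  · rw [weight, div_le_iff₀ (pos_iff_ne_zero.2 h)]
    exact dens_le_ratioBound_mul hB s a

lemma measurable_weight (πe πb : Policy ν) :
    Measurable (fun x : 𝒮 × 𝒜 => weight πe πb x.1 x.2) :=
  πe.measurable_dens.div πb.measurable_dens

lemma measurable_contextReward :
    Measurable (contextReward : (𝒮 × 𝒜) × ℝ → 𝒮 × ℝ) := by
  unfold contextReward; fun_prop

/-- The law of the uniform variables. -/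
abbrev unif : Measure ℝ := volume.restrict (Set.Icc (0 : ℝ) 1)

instance : IsProbabilityMeasure unif := ⟨by simp⟩

lemma unif_Iic {r : ℝ≥0} (hr : r ≤ 1) : unif (Set.Iic (r : ℝ)) = r := by
  rw [Measure.restrict_apply measurableSet_Iic]
  have : Set.Iic (r : ℝ) ∩ Set.Icc 0 1 = Set.Icc 0 (r : ℝ) := by
    ext x
    have : (r : ℝ) ≤ 1 := hr
    simp only [Set.mem_inter_iff, Set.mem_Iic, Set.mem_Icc]
    constructor
    · rintro ⟨h1, h2, -⟩; exact ⟨h2, h1⟩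
    · rintro ⟨h1, h2⟩; exact ⟨h2, h1, by linarith⟩
  rw [this, Real.volume_Icc, sub_zero, ENNReal.ofReal_coe_nnreal]

/-- The acceptance region of rejection sampling. -/
def acceptRegion (πe πb : Policy ν) : Set (((𝒮 × 𝒜) × ℝ) × ℝ) :=
  {y | y.2 ≤ 1 / (ratioBound πe πb : ℝ) * (weight πe πb y.1.1.1 y.1.1.2 : ℝ)}

lemma measurableSet_acceptRegion (πe πb : Policy ν) : MeasurableSet (acceptRegion πe πb) := by
  refine measurableSet_le measurable_snd (Measurable.const_mul ?_ _)
  exact ((measurable_weight πe πb).comp (measurable_fst.comp measurable_fst)).coe_nnreal_real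

variable [IsSFiniteKernel ν] (PS : Measure 𝒮) [IsProbabilityMeasure PS]
  (PR : Kernel (𝒮 × 𝒜) ℝ) [IsMarkovKernel PR]

instance isProbabilityMeasure_obsLaw (π : Policy ν) : IsProbabilityMeasure (obsLaw PS PR π) := by
  unfold obsLaw; infer_instance

instance isProbabilityMeasure_contextRewardLaw (π : Policy ν) :
    IsProbabilityMeasure (contextRewardLaw PS PR π) :=
  Measure.isProbabilityMeasure_map measurable_contextReward.aemeasurable

lemma lintegral_obsLaw (π : Policy ν) {f : (𝒮 × 𝒜) × ℝ → ℝ≥0∞} (hf : Measurable f) :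
    ∫⁻ x, f x ∂(obsLaw PS PR π) =
      ∫⁻ s, ∫⁻ a, π.dens s a * ∫⁻ r, f ((s, a), r) ∂(PR (s, a)) ∂(ν s) ∂PS := by
  have hm : Measurable (Function.uncurry fun s a => (π.dens s a : ℝ≥0∞)) :=
    π.measurable_dens.coe_nnreal_ennreal
  have h1 : Measurable fun x : 𝒮 × 𝒜 => ∫⁻ r, f (x, r) ∂(PR x) :=
    hf.lintegral_kernel_prod_right'
  rw [obsLaw, Measure.lintegral_compProd hf, Measure.lintegral_compProd h1]
  refine lintegral_congr fun s => ?_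
  exact Kernel.lintegral_withDensity _ hm s (h1.comp measurable_prodMk_left)

/-- Reweighting by the importance weight turns the behavior law into the target law. -/
lemma lintegral_weight_mul {πe πb : Policy ν} (hB : (ratioBounds πe πb).Nonempty)
    {f : (𝒮 × 𝒜) × ℝ → ℝ≥0∞} (hf : Measurable f) :
    ∫⁻ x, weight πe πb x.1.1 x.1.2 * f x ∂(obsLaw PS PR πb) = ∫⁻ x, f x ∂(obsLaw PS PR πe) := by
  have hw : Measurable fun x : (𝒮 × 𝒜) × ℝ => (weight πe πb x.1.1 x.1.2 : ℝ≥0∞) :=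
    ((measurable_weight πe πb).comp measurable_fst).coe_nnreal_ennreal
  refine (lintegral_obsLaw PS PR πb (hw.mul hf)).trans ?_
  rw [lintegral_obsLaw PS PR πe hf]
  refine lintegral_congr fun s => lintegral_congr fun a => ?_
  simp only [Pi.mul_apply]
  rw [lintegral_const_mul' _ _ ENNReal.coe_ne_top, ← mul_assoc, ← ENNReal.coe_mul,
    dens_mul_weight hB]

/-- The accepted observations have the target law. -/
lemma map_restrict_acceptRegion {πe πb : Policy ν} (hB : (ratioBounds πe πb).Nonempty) :
    (((obsLaw PS PR πb).prod unif).restrict (acceptRegion πe πb)).map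
        (fun y => contextReward y.1) =
      (ratioBound πe πb)⁻¹ • contextRewardLaw PS PR πe := by
  have hne : Nonempty 𝒮 := PS.nonempty_of_neZero
  set B := ratioBound πe πb with hBdef
  have hB1 : 1 ≤ B := one_le_ratioBound hB
  have hB0 : B ≠ 0 := (zero_lt_one.trans_le hB1).ne'
  have hcr : Measurable fun y : ((𝒮 × 𝒜) × ℝ) × ℝ => contextReward y.1 :=
    measurable_contextReward.comp measurable_fst
  ext A hA
  have hind : Measurable fun x : (𝒮 × 𝒜) × ℝ =>
      (contextReward ⁻¹' A).indicator (fun _ => (1 : ℝ≥0∞)) x :=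
    measurable_const.indicator (measurable_contextReward hA)
  rw [Measure.map_apply hcr hA, Measure.restrict_apply (hcr hA),
    Measure.prod_apply ((hcr hA).inter (measurableSet_acceptRegion πe πb))]
  -- Given the observation, the uniform variable accepts it with probability `w / B`, which is a
  -- probability because `w ≤ B`.
  have hsec : ∀ x : (𝒮 × 𝒜) × ℝ,
      unif (Prod.mk x ⁻¹' ((fun y : ((𝒮 × 𝒜) × ℝ) × ℝ => contextReward y.1) ⁻¹' A ∩
        acceptRegion πe πb)) =
      (B⁻¹ : ℝ≥0) * (weight πe πb x.1.1 x.1.2 *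
        (contextReward ⁻¹' A).indicator (fun _ => (1 : ℝ≥0∞)) x) := by
    intro x
    by_cases hx : contextReward x ∈ A
    · have hset : Prod.mk x ⁻¹' ((fun y : ((𝒮 × 𝒜) × ℝ) × ℝ => contextReward y.1) ⁻¹' A ∩
          acceptRegion πe πb) = Set.Iic (((B⁻¹ * weight πe πb x.1.1 x.1.2 : ℝ≥0)) : ℝ) := by
        ext v
        simp [acceptRegion, hx, ← hBdef]
      rw [hset, unif_Iic, Set.indicator_of_mem (by exact hx), mul_one, ENNReal.coe_mul]
      calc B⁻¹ * weight πe πb x.1.1 x.1.2 ≤ B⁻¹ * B := by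
            gcongr; exact weight_le_ratioBound hB _ _
        _ = 1 := inv_mul_cancel₀ hB0
    · have hset : Prod.mk x ⁻¹' ((fun y : ((𝒮 × 𝒜) × ℝ) × ℝ => contextReward y.1) ⁻¹' A ∩
          acceptRegion πe πb) = ∅ := by
        ext v
        simp [hx]
      rw [hset, measure_empty, Set.indicator_of_notMem (by exact hx), mul_zero, mul_zero]
  simp_rw [hsec]
  rw [lintegral_const_mul' _ _ ENNReal.coe_ne_top, lintegral_weight_mul PS PR hB hind,
    lintegral_indicator_const (measurable_contextReward hA), one_mul, Measure.smul_apply,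
    contextRewardLaw, Measure.map_apply measurable_contextReward hA]
  rfl

/-- The joint law of an observation, restricted to acceptance or rejection, seen through the
context-reward pair. -/
def pairLaw (πe πb : Policy ν) {ι : Type*} [DecidableEq ι] (J : Finset ι) (i : ι) :
    Measure (𝒮 × ℝ) :=
  (((obsLaw PS PR πb).prod unif).restrict
    (if i ∈ J then acceptRegion πe πb else (acceptRegion πe πb)ᶜ)).map
      (fun y => contextReward y.1)

instance isFiniteMeasure_pairLaw (πe πb : Policy ν) {ι : Type*} [DecidableEq ι] (J : Finset ι)
    (i : ι) : IsFiniteMeasure (pairLaw PS PR πe πb J i) := by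
  unfold pairLaw; infer_instance

lemma pairLaw_of_mem {πe πb : Policy ν} (hB : (ratioBounds πe πb).Nonempty) {ι : Type*}
    [DecidableEq ι] {J : Finset ι} {i : ι} (hi : i ∈ J) :
    pairLaw PS PR πe πb J i = (ratioBound πe πb)⁻¹ • contextRewardLaw PS PR πe := by
  rw [pairLaw, if_pos hi, map_restrict_acceptRegion PS PR hB]

/-- The accepted part is `1 / B` times a probability law, so its total mass is the acceptance
probability. -/
lemma pairLaw_real_univ {πe πb : Policy ν} (hB : (ratioBounds πe πb).Nonempty) {ι : Type*}
    [DecidableEq ι] (J : Finset ι) (i : ι) :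
    (pairLaw PS PR πe πb J i).real Set.univ =
      if i ∈ J then (ratioBound πe πb : ℝ)⁻¹ else 1 - (ratioBound πe πb : ℝ)⁻¹ := by
  have hcr : Measurable fun y : ((𝒮 × 𝒜) × ℝ) × ℝ => contextReward y.1 :=
    measurable_contextReward.comp measurable_fst
  have hD := measurableSet_acceptRegion πe πb
  have hacc : ((obsLaw PS PR πb).prod unif).real (acceptRegion πe πb) =
      (ratioBound πe πb : ℝ)⁻¹ := by
    have h := congrArg (fun m => m.real Set.univ) (map_restrict_acceptRegion PS PR hB)
    simp only [measureReal_nnreal_smul_apply, probReal_univ, mul_one] at h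
    rwa [map_measureReal_apply hcr MeasurableSet.univ, Set.preimage_univ,
      measureReal_restrict_apply MeasurableSet.univ, Set.univ_inter] at h
  rw [pairLaw, map_measureReal_apply hcr MeasurableSet.univ, Set.preimage_univ,
    measureReal_restrict_apply MeasurableSet.univ, Set.univ_inter]
  split_ifs
  · exact hacc
  · rw [probReal_compl_eq_one_sub hD, hacc]

lemma prod_pairLaw_real_univ {πe πb : Policy ν} (hB : (ratioBounds πe πb).Nonempty) {n : ℕ}
    (J : Finset (Fin n)) :
    ∏ i, (pairLaw PS PR πe πb J i).real Set.univ =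
      (ratioBound πe πb : ℝ)⁻¹ ^ J.card * (1 - (ratioBound πe πb : ℝ)⁻¹) ^ (n - J.card) := by
  simp_rw [pairLaw_real_univ PS PR hB]
  rw [Finset.prod_ite]
  simp [Finset.filter_not, Finset.card_sdiff]

end Rejection

/-! ### The good event for frozen accepted and calibration sets. -/

/-- An acceptance pattern is a box, and restricting a product measure to a box restricts each
factor; hence the coordinates stay independent given the pattern. -/
lemma pi_box_inter_preimage {ι Y Z : Type*} [Fintype ι] [MeasurableSpace Y] [MeasurableSpace Z]
    (μ : ι → Measure Y) [∀ i, IsFiniteMeasure (μ i)] {s : ι → Set Y}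
    {f : Y → Z} (hf : Measurable f) {E : Set (ι → Z)} (hE : MeasurableSet E) :
    Measure.pi μ ((fun y i => f (y i)) ⁻¹' E ∩ Set.univ.pi s) =
      Measure.pi (fun i => ((μ i).restrict (s i)).map f) E := by
  have hF : Measurable fun (y : ι → Y) i => f (y i) := by fun_prop
  rw [← Measure.restrict_apply (hF hE), Measure.restrict_pi_pi, ← Measure.map_apply hF hE,
    Measure.pi_map_pi fun i => hf.aemeasurable]

/-- The score fitted on the coordinates of `x` with index in `T`. -/
def fitScore {𝒮 : Type*} [MeasurableSpace 𝒮] (qlo qup : QuantileAlg 𝒮) {n : ℕ}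
    (T : Finset (Fin n)) (x : Fin n → 𝒮 × ℝ) : 𝒮 × ℝ → ℝ :=
  score (qlo.fit ((T.sort (· ≤ ·)).map x)) (qup.fit ((T.sort (· ≤ ·)).map x))

lemma fitScore_congr {𝒮 : Type*} [MeasurableSpace 𝒮] (qlo qup : QuantileAlg 𝒮) {n : ℕ}
    {T : Finset (Fin n)} {x x' : Fin n → 𝒮 × ℝ} (h : ∀ i ∈ T, x i = x' i) :
    fitScore qlo qup T x = fitScore qlo qup T x' := by
  have : (T.sort (· ≤ ·)).map x = (T.sort (· ≤ ·)).map x' :=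
    List.map_congr_left fun i hi => h i ((Finset.mem_sort _).1 hi)
  rw [fitScore, fitScore, this]

lemma measurable_fitScore {𝒮 : Type*} [MeasurableSpace 𝒮] (qlo qup : QuantileAlg 𝒮) {n : ℕ}
    (T : Finset (Fin n)) : Measurable (Function.uncurry (fitScore qlo qup T)) := by
  set L := T.sort (· ≤ ·) with hL
  -- The algorithms are measurable for each fixed sample size, so the list is rewritten as a vector
  -- of length `L.length`.
  have hlist : ∀ x : Fin n → 𝒮 × ℝ, L.map x = List.ofFn fun i : Fin L.length => x (L.get i) := by
    intro x
    rw [List.ofFn_comp' L.get x, List.ofFn_get]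
  have harg : Measurable fun p : (Fin n → 𝒮 × ℝ) × (𝒮 × ℝ) =>
      ((fun i : Fin L.length => p.1 (L.get i)), p.2.1) := by fun_prop
  have hfit : ∀ q : QuantileAlg 𝒮, Measurable fun p : (Fin n → 𝒮 × ℝ) × (𝒮 × ℝ) =>
      q.fit (L.map p.1) p.2.1 := by
    intro q
    simp_rw [hlist]
    exact (q.measurable_fit L.length).comp harg
  exact ((hfit qlo).sub (by fun_prop)).max (Measurable.sub (by fun_prop) (hfit qup))

open Classical in
/-- The event, in terms of the context-reward pairs, that the miscoverage is in `(p, ε]` when `J`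
is accepted and `K` is the calibration set. -/
def goodSet {𝒮 : Type*} [MeasurableSpace 𝒮] (Q : Measure (𝒮 × ℝ)) (qlo qup : QuantileAlg 𝒮)
    (ε δ p : ℝ) {n : ℕ} (J K : Finset (Fin n)) : Set (Fin n → 𝒮 × ℝ) :=
  {x | ((K.filter (fun i => Q.real {z | fitScore qlo qup (J \ K) x (x i) <
      fitScore qlo qup (J \ K) x z} ≤ p)).card : ℤ) ≤ cutoff K.card ε δ} \
  {x | ((K.filter (fun i => Q.real {z | fitScore qlo qup (J \ K) x (x i) <
      fitScore qlo qup (J \ K) x z} ≤ ε)).card : ℤ) ≤ cutoff K.card ε δ}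

open Classical in
lemma measurableSet_card_tail_le {𝒮 : Type*} [MeasurableSpace 𝒮] (Q : Measure (𝒮 × ℝ))
    [IsProbabilityMeasure Q] (qlo qup : QuantileAlg 𝒮) (c : ℝ) (k : ℤ) {n : ℕ}
    (T K : Finset (Fin n)) :
    MeasurableSet {x | ((K.filter (fun i => Q.real {z | fitScore qlo qup T x (x i) <
      fitScore qlo qup T x z} ≤ c)).card : ℤ) ≤ k} := by
  have hsc := measurable_fitScore qlo qup T
  refine measurableSet_card_filter_le K (A := fun i => {x : Fin n → 𝒮 × ℝ |
    Q.real {z | fitScore qlo qup T x (x i) < fitScore qlo qup T x z} ≤ c}) (fun i => ?_) k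
  refine measurableSet_le (measurable_real_tail Q ?_ hsc) measurable_const
  exact hsc.comp (measurable_id.prodMk (measurable_pi_apply i))

lemma measurableSet_goodSet {𝒮 : Type*} [MeasurableSpace 𝒮] (Q : Measure (𝒮 × ℝ))
    [IsProbabilityMeasure Q] (qlo qup : QuantileAlg 𝒮) (ε δ p : ℝ) {n : ℕ}
    (J K : Finset (Fin n)) : MeasurableSet (goodSet Q qlo qup ε δ p J K) :=
  (measurableSet_card_tail_le Q qlo qup _ _ _ _).diff (measurableSet_card_tail_le Q qlo qup _ _ _ _)

lemma miscoverage_mem_of_mem_goodSet {𝒮 : Type*} [MeasurableSpace 𝒮] {Q : Measure (𝒮 × ℝ)}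
    [IsProbabilityMeasure Q] {qlo qup : QuantileAlg 𝒮} {ε δ p : ℝ} (hδ : 0 ≤ δ) {n : ℕ}
    {J K : Finset (Fin n)} {x : Fin n → 𝒮 × ℝ} (hx : x ∈ goodSet Q qlo qup ε δ p J K) :
    let L := ((J \ K).sort (· ≤ ·)).map x
    let m := miscoverage Q (interval (qlo.fit L) (qup.fit L)
      (threshold ε δ (K.val.map fun i => score (qlo.fit L) (qup.fit L) (x i))))
    p < m ∧ m ≤ ε := by
  intro L m
  obtain ⟨h1, h2⟩ := hx
  obtain ⟨-, hk, -⟩ := cutoff_spec (M := K.card) (ε := ε) hδ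
  simp only [Set.mem_ofPred_eq, not_le] at h1 h2
  -- A cardinality below the cutoff excludes `k = -1`, so the threshold is finite on the good set.
  have h0 : 0 ≤ cutoff K.card ε δ := le_trans (Int.natCast_nonneg _) h1
  have key := miscoverage_interval_le_iff Q (qlo.fit L) (qup.fit L) ε δ K
    (fun i => score (qlo.fit L) (qup.fit L) (x i)) h0 hk
  refine ⟨?_, ?_⟩
  · by_contra! hcon
    have := (key p).1 hcon
    have h3 := lt_of_lt_of_le (Int.lt_add_one_of_le le_rfl) this
    exact absurd h1 (not_le.2 h3)
  · exact (key ε).2 h2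

lemma measurableSet_ties {𝒮 : Type*} [MeasurableSpace 𝒮] (qlo qup : QuantileAlg 𝒮) {n : ℕ}
    (T K : Finset (Fin n)) :
    MeasurableSet {x : Fin n → 𝒮 × ℝ |
      ¬ Set.InjOn (fun i => fitScore qlo qup T x (x i)) K} := by
  have hsc := measurable_fitScore qlo qup T
  have hm : ∀ i, Measurable fun x : Fin n → 𝒮 × ℝ => fitScore qlo qup T x (x i) := fun i =>
    hsc.comp (measurable_id.prodMk (measurable_pi_apply i))
  have : {x : Fin n → 𝒮 × ℝ | ¬ Set.InjOn (fun i => fitScore qlo qup T x (x i)) K} =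
      ⋃ i ∈ K, ⋃ j ∈ K, ⋃ _ : i ≠ j,
        {x | fitScore qlo qup T x (x i) = fitScore qlo qup T x (x j)} := by
    ext x
    simp only [Set.InjOn, Set.mem_ofPred_eq, Set.mem_iUnion, Finset.mem_coe]
    push Not
    constructor
    · rintro ⟨i, hi, j, hj, h, hne⟩
      exact ⟨i, hi, j, hj, hne, h⟩
    · rintro ⟨i, hi, j, hj, hne, h⟩
      exact ⟨i, hi, j, hj, h, hne⟩
  rw [this]
  exact Finset.measurableSet_biUnion _ fun i _ => Finset.measurableSet_biUnion _ fun j _ =>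
    MeasurableSet.iUnion fun _ => measurableSet_eq_fun (hm i) (hm j)

/-! ### Averaging over the number of accepted observations. -/

/-- The coefficient of `1 / √(n : ℝ)` in the loss of probability, divided by `B`. -/
def lossCoeff (γ Δ δ : ℝ) : ℝ := (√(-2 * Real.log δ) + 1) / (2 * Δ * √γ) + 1 / √γ

/-- A lower bound for the probability of success when `N` observations are accepted. -/
def successBound (γ Δ δ : ℝ) (n N : ℕ) : ℝ :=
  1 - δ - lossCoeff γ Δ δ * ((n + 1) / (N + 1) / √(n : ℝ))

/-- Here `γ * N ≤ 1`, and the summand `1 / √γ` of `lossCoeff` pushes the loss to at least `1`. This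
disposes of calibration sets too small for ties to detect atoms. -/
lemma successBound_nonpos {γ Δ δ : ℝ} (hγ : γ ∈ Set.Ioo (0 : ℝ) 1) (hΔ : 0 < Δ) (hδ : 0 < δ)
    {n N : ℕ} (hn : 1 ≤ n) (hN : N ≤ n) (hM : ⌈γ * (N : ℝ)⌉₊ ≤ 1) :
    successBound γ Δ δ n N ≤ 0 := by
  obtain ⟨hγ0, hγ1⟩ := hγ
  have hsγ : 0 < √γ := Real.sqrt_pos.2 hγ0
  have hn' : (1 : ℝ) ≤ n := by exact_mod_cast hn
  have hsn : 1 ≤ √(n : ℝ) := Real.one_le_sqrt.2 hn'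
  have hr : 0 ≤ ((n : ℝ) + 1) / (N + 1) / √(n : ℝ) := by positivity
  have h1 : √γ ≤ ((n : ℝ) + 1) / (N + 1) / √(n : ℝ) := by
    rcases Nat.eq_zero_or_pos N with rfl | hN0
    · have h2 : √γ ≤ 1 := Real.sqrt_le_one.2 hγ1.le
      refine h2.trans ?_
      have hsq : √(n : ℝ) ^ 2 = n := Real.sq_sqrt (by linarith)
      rw [le_div_iff₀ (by linarith)]
      simp only [Nat.cast_zero, zero_add, div_one, one_mul]
      nlinarith
    · refine le_trans ?_ (one_div_sqrt_le hN0 hN)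
      have hN' : (0 : ℝ) < N := by exact_mod_cast hN0
      rw [le_div_iff₀ (Real.sqrt_pos.2 hN'), ← Real.sqrt_mul hγ0.le, Real.sqrt_le_one]
      have := Nat.ceil_le.1 hM
      simpa using this
  have h2 : 1 / √γ ≤ lossCoeff γ Δ δ := by
    unfold lossCoeff
    have : 0 ≤ (√(-2 * Real.log δ) + 1) / (2 * Δ * √γ) := by positivity
    linarith
  have h0 : 0 ≤ lossCoeff γ Δ δ := le_trans (by positivity) h2
  have h3 : 1 ≤ lossCoeff γ Δ δ * (((n : ℝ) + 1) / (N + 1) / √(n : ℝ)) := by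
    calc (1 : ℝ) = 1 / √γ * √γ := by field_simp
      _ ≤ _ := by gcongr
  unfold successBound
  linarith

lemma successBound_le {γ Δ δ ε : ℝ} (hε : ε ∈ Set.Ioo (0 : ℝ) 1) (hγ : γ ∈ Set.Ioo (0 : ℝ) 1)
    (hΔ : Δ ∈ Set.Ioo (0 : ℝ) ε) (hδ : δ ∈ Set.Ioo (0 : ℝ) 1) {n N : ℕ} (hN : N ≤ n)
    (hM : 1 ≤ ⌈γ * (N : ℝ)⌉₊) :
    successBound γ Δ δ n N ≤
      binCDF ⌈γ * (N : ℝ)⌉₊ (ε - Δ) (cutoff ⌈γ * (N : ℝ)⌉₊ ε δ) -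
        binCDF ⌈γ * (N : ℝ)⌉₊ ε (cutoff ⌈γ * (N : ℝ)⌉₊ ε δ) := by
  refine le_trans ?_ (le_binCDF_sub_binCDF_cutoff hM hε hδ hΔ)
  set M := ⌈γ * (N : ℝ)⌉₊ with hMdef
  have hΔ0 := hΔ.1
  have hγ0 := hγ.1
  have hN0 : 1 ≤ N := by
    by_contra! h
    have : N = 0 := by omega
    rw [hMdef, this] at hM
    simp at hM
  have hsγ : 0 < √γ := Real.sqrt_pos.2 hγ0
  have hN' : (0 : ℝ) < N := by exact_mod_cast hN0
  have hsN : 0 < √(N : ℝ) := Real.sqrt_pos.2 hN'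
  have hMN : √γ * √(N : ℝ) ≤ √(M : ℝ) := by
    rw [← Real.sqrt_mul hγ0.le]
    exact Real.sqrt_le_sqrt (Nat.le_ceil _)
  have hr : 0 ≤ ((n : ℝ) + 1) / (N + 1) / √(n : ℝ) := by positivity
  have h1 : (√(-2 * Real.log δ) + 1) / (2 * Δ * √(M : ℝ)) ≤
      lossCoeff γ Δ δ * (((n : ℝ) + 1) / (N + 1) / √(n : ℝ)) := by
    calc (√(-2 * Real.log δ) + 1) / (2 * Δ * √(M : ℝ))
        ≤ (√(-2 * Real.log δ) + 1) / (2 * Δ * (√γ * √(N : ℝ))) := by gcongr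
      _ = (√(-2 * Real.log δ) + 1) / (2 * Δ * √γ) * (1 / √(N : ℝ)) := by field_simp
      _ ≤ lossCoeff γ Δ δ * (((n : ℝ) + 1) / (N + 1) / √(n : ℝ)) := by
        have h2 := one_div_sqrt_le hN0 hN
        unfold lossCoeff
        gcongr
        have : 0 ≤ 1 / √γ := by positivity
        linarith
  unfold successBound
  linarith

/-- Averaging the bound over a binomial number of accepted observations. -/
lemma le_sum_binPMF_successBound {γ Δ δ B : ℝ} (hγ : 0 < γ) (hΔ : 0 < Δ) (hB : 1 ≤ B) (n : ℕ) :
    1 - δ - lossCoeff γ Δ δ * B / √(n : ℝ) ≤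
      ∑ N ∈ Finset.range (n + 1), binPMF n B⁻¹ N * successBound γ Δ δ n N := by
  have h := sum_binPMF_div_le n (q := B⁻¹) (by positivity) (inv_le_one_of_one_le₀ hB)
  rw [one_div, inv_inv] at h
  have hc : 0 ≤ lossCoeff γ Δ δ / √(n : ℝ) := by unfold lossCoeff; positivity
  -- `successBound` is affine in `(n + 1) / (N + 1)`, so only the mean of that ratio enters.
  have hsum : ∑ N ∈ Finset.range (n + 1), binPMF n B⁻¹ N * successBound γ Δ δ n N =
      (1 - δ) * ∑ N ∈ Finset.range (n + 1), binPMF n B⁻¹ N - lossCoeff γ Δ δ / √(n : ℝ) *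
        ∑ N ∈ Finset.range (n + 1), binPMF n B⁻¹ N * ((n + 1) / (N + 1)) := by
    rw [Finset.mul_sum, Finset.mul_sum, ← Finset.sum_sub_distrib]
    refine Finset.sum_congr rfl fun N _ => ?_
    unfold successBound
    ring
  rw [hsum, sum_binPMF]
  have := mul_le_mul_of_nonneg_left h hc
  have e : lossCoeff γ Δ δ * B / √(n : ℝ) = lossCoeff γ Δ δ / √(n : ℝ) * B := by ring
  rw [e]
  linarith

/-- The Hoeffding part of the loss equals the second term of the constant, the part `B / √γ` is
strictly below the first, and the third is nonnegative. The strict inequality of the theorem comes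
from here. -/
lemma lossCoeff_mul_lt_boundConst {γ ε Δ δ B : ℝ} (hε : ε ∈ Set.Ioo (0 : ℝ) 1)
    (hγ : γ ∈ Set.Ioo (0 : ℝ) 1) (hΔ : Δ ∈ Set.Ioo (0 : ℝ) ε) (hδ : δ ∈ Set.Ioo (0 : ℝ) 1)
    (hB : 1 ≤ B) : lossCoeff γ Δ δ * B < boundConst B γ ε Δ δ := by
  obtain ⟨hε0, hε1⟩ := hε
  obtain ⟨hγ0, hγ1⟩ := hγ
  obtain ⟨hΔ0, hΔ1⟩ := hΔ
  have hδ1 := hδ.2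
  have hsγ : 0 < √γ := Real.sqrt_pos.2 hγ0
  have hp : 0 < (ε - Δ) * (1 - ε + Δ) := mul_pos (by linarith) (by linarith)
  have h1 : B / √γ < 7 * B / √(γ * (ε - Δ) * (1 - ε + Δ)) := by
    have h2 : √(γ * (ε - Δ) * (1 - ε + Δ)) ≤ √γ := by
      refine Real.sqrt_le_sqrt ?_
      rw [mul_assoc]
      refine mul_le_of_le_one_right hγ0.le ?_
      nlinarith
    have h3 : 0 < √(γ * (ε - Δ) * (1 - ε + Δ)) := by
      rw [mul_assoc]; exact Real.sqrt_pos.2 (mul_pos hγ0 hp)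
    calc B / √γ < 7 * B / √γ := by gcongr; linarith
      _ ≤ _ := by gcongr
  have h2 : 0 ≤ (1 - δ) * (√((⌊mOne ε Δ δ / γ⌋₊ : ℝ) * B) + B / 2) :=
    mul_nonneg (by linarith) (by positivity)
  have h3 : lossCoeff γ Δ δ * B =
      B / √γ + (√(-2 * Real.log δ) + 1) * B / (2 * Δ * √γ) := by
    unfold lossCoeff; ring
  rw [h3, boundConst]
  linarith

/-! ### The joint law of the data and the algorithm on frozen index sets. -/

lemma map_prodMk_eq_pi {Ω 𝒳 𝒴 ι : Type*} [Fintype ι] [MeasurableSpace Ω] [MeasurableSpace 𝒳]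
    [MeasurableSpace 𝒴] {P : Measure Ω} [IsProbabilityMeasure P] {μ : Measure 𝒳} {κ : Measure 𝒴}
    [IsProbabilityMeasure μ] [IsProbabilityMeasure κ] {X : ι → Ω → 𝒳} {V : ι → Ω → 𝒴}
    (hXm : ∀ i, Measurable (X i)) (hVm : ∀ i, Measurable (V i))
    (hXlaw : ∀ i, P.map (X i) = μ) (hXindep : iIndepFun X P)
    (hVlaw : ∀ i, P.map (V i) = κ) (hVindep : iIndepFun V P)
    (hXV : IndepFun (fun ω i => X i ω) (fun ω i => V i ω) P) :
    P.map (fun ω i => (X i ω, V i ω)) = Measure.pi (fun _ => μ.prod κ) := by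
  have hX := (iIndepFun_iff_map_fun_eq_pi_map fun i => (hXm i).aemeasurable).1 hXindep
  have hV := (iIndepFun_iff_map_fun_eq_pi_map fun i => (hVm i).aemeasurable).1 hVindep
  have hXm' : Measurable fun ω i => X i ω := measurable_pi_lambda _ hXm
  have hVm' : Measurable fun ω i => V i ω := measurable_pi_lambda _ hVm
  have hj := (indepFun_iff_map_prod_eq_prod_map_map hXm'.aemeasurable hVm'.aemeasurable).1 hXV
  simp_rw [hXlaw] at hX
  simp_rw [hVlaw] at hV
  rw [hX, hV] at hj
  have hmp := (measurePreserving_arrowProdEquivProdArrow 𝒳 𝒴 ι (fun _ => μ) (fun _ => κ)).symm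
  have h := hmp.map_eq
  rw [← hj, Measure.map_map hmp.measurable (hXm'.prodMk hVm')] at h
  exact h

section

variable {𝒮 𝒜 : Type*} [MeasurableSpace 𝒮] [MeasurableSpace 𝒜] {ν : Kernel 𝒮 𝒜}

/-- The data and uniform variables for which `J` is the set of accepted indices. -/
def acceptBox (πe πb : Policy ν) {n : ℕ} (J : Finset (Fin n)) :
    Set (Fin n → ((𝒮 × 𝒜) × ℝ) × ℝ) :=
  Set.univ.pi fun i => if i ∈ J then acceptRegion πe πb else (acceptRegion πe πb)ᶜ

lemma mem_acceptBox_iff (πe πb : Policy ν) {n : ℕ} (J : Finset (Fin n))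
    (x : Fin n → (𝒮 × 𝒜) × ℝ) (v : Fin n → ℝ) :
    (fun i => (x i, v i)) ∈ acceptBox πe πb J ↔ accepted πe πb x v = J := by
  simp only [acceptBox, Set.mem_pi, Set.mem_univ, true_implies, Finset.ext_iff, accepted,
    Finset.mem_filter, Finset.mem_univ, true_and]
  refine forall_congr' fun i => ?_
  by_cases hi : i ∈ J
  · simp [hi, acceptRegion]
  · simp [hi, acceptRegion]

lemma measurableSet_acceptBox (πe πb : Policy ν) {n : ℕ} (J : Finset (Fin n)) :
    MeasurableSet (acceptBox πe πb J) :=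
  MeasurableSet.univ_pi fun i => by
    split_ifs
    exacts [measurableSet_acceptRegion πe πb, (measurableSet_acceptRegion πe πb).compl]

/-- The context-reward pairs of a sample. -/
def pairsOf {n : ℕ} (y : Fin n → ((𝒮 × 𝒜) × ℝ) × ℝ) (i : Fin n) : 𝒮 × ℝ :=
  contextReward (y i).1

lemma measurable_pairsOf {n : ℕ} :
    Measurable (pairsOf : (Fin n → ((𝒮 × 𝒜) × ℝ) × ℝ) → Fin n → 𝒮 × ℝ) :=
  measurable_pi_lambda _ fun i =>
    measurable_contextReward.comp (measurable_fst.comp (measurable_pi_apply i))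

lemma tau_eq_fitScore (πe πb : Policy ν) {γ : ℝ} {n : ℕ} {𝒢 : Type*} [MeasurableSpace 𝒢]
    (σ : SplitRule γ n 𝒢) (qlo qup : QuantileAlg 𝒮) {x : Fin n → (𝒮 × 𝒜) × ℝ} {v : Fin n → ℝ}
    {g : 𝒢} {J K : Finset (Fin n)} (hJ : accepted πe πb x v = J) (hK : σ.calib g J = K)
    (i : Fin n) :
    tau πe πb σ qlo qup x v g i =
      fitScore qlo qup (J \ K) (fun j => contextReward (x j)) (contextReward (x i)) := by
  rw [tau, trainSample, calibSet, hJ, hK]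
  rfl

lemma miscoverage_predictionInterval_mem (πe πb : Policy ν) {γ : ℝ} {n : ℕ} {𝒢 : Type*}
    [MeasurableSpace 𝒢] (σ : SplitRule γ n 𝒢) {qlo qup : QuantileAlg 𝒮} {Q : Measure (𝒮 × ℝ)}
    [IsProbabilityMeasure Q] {ε δ p : ℝ} (hδ : 0 ≤ δ)
    {x : Fin n → (𝒮 × 𝒜) × ℝ} {v : Fin n → ℝ}
    {g : 𝒢} {J K : Finset (Fin n)} (hJ : accepted πe πb x v = J) (hK : σ.calib g J = K)
    (hx : (fun i => contextReward (x i)) ∈ goodSet Q qlo qup ε δ p J K) :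
    p < miscoverage Q (predictionInterval πe πb σ qlo qup ε δ x v g) ∧
      miscoverage Q (predictionInterval πe πb σ qlo qup ε δ x v g) ≤ ε := by
  have h := miscoverage_mem_of_mem_goodSet hδ hx
  have htau : tau πe πb σ qlo qup x v g = _ :=
    funext fun i => tau_eq_fitScore πe πb σ qlo qup hJ hK i
  rw [predictionInterval, htau, trainSample, calibSet, hJ, hK]
  exact h

variable [IsSFiniteKernel ν] (PS : Measure 𝒮) [IsProbabilityMeasure PS]
  (PR : Kernel (𝒮 × 𝒜) ℝ) [IsMarkovKernel PR]

/-- Joint probability of a splitting event, an acceptance pattern and an event for the pairs. -/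
lemma measure_split_inter_accept {Ω 𝒢 : Type*} [MeasurableSpace Ω] [MeasurableSpace 𝒢]
    {P : Measure Ω} [IsProbabilityMeasure P] {πe πb : Policy ν} {n : ℕ} {G : Ω → 𝒢}
    {Y : Ω → Fin n → ((𝒮 × 𝒜) × ℝ) × ℝ} (hY : Measurable Y)
    (hYlaw : P.map Y = Measure.pi fun _ => (obsLaw PS PR πb).prod unif) (hGY : IndepFun G Y P)
    (J : Finset (Fin n)) {A : Set 𝒢} (hA : MeasurableSet A) {E : Set (Fin n → 𝒮 × ℝ)}
    (hE : MeasurableSet E) :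
    P (G ⁻¹' A ∩ Y ⁻¹' (pairsOf ⁻¹' E ∩ acceptBox πe πb J)) =
      P (G ⁻¹' A) * Measure.pi (pairLaw PS PR πe πb J) E := by
  have hm := (measurable_pairsOf (n := n) hE).inter (measurableSet_acceptBox πe πb J)
  rw [hGY.measure_inter_preimage_eq_mul _ _ hA hm, ← Measure.map_apply hY hm, hYlaw]
  congr 1
  exact pi_box_inter_preimage (fun _ => (obsLaw PS PR πb).prod unif)
    (measurable_contextReward.comp measurable_fst) hE

/-- Given the accepted set `J` and the calibration set `K`, the miscoverage is in the target range
with the desired probability. -/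
lemma le_measureReal_goodSet {πe πb : Policy ν} (hB : (ratioBounds πe πb).Nonempty)
    {ε δ γ Δ : ℝ} (hε : ε ∈ Set.Ioo (0 : ℝ) 1) (hδ : δ ∈ Set.Ioo (0 : ℝ) 1)
    (hγ : γ ∈ Set.Ioo (0 : ℝ) 1) (hΔ : Δ ∈ Set.Ioo (0 : ℝ) ε) {n : ℕ} (hn : 1 ≤ n)
    (qlo qup : QuantileAlg 𝒮) {J K : Finset (Fin n)} (hKJ : K ⊆ J)
    (hK : K.card = ⌈γ * (J.card : ℝ)⌉₊)
    (hties : ∀ᵐ x ∂Measure.pi (pairLaw PS PR πe πb J),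
      Set.InjOn (fun i => fitScore qlo qup (J \ K) x (x i)) K) :
    (ratioBound πe πb : ℝ)⁻¹ ^ J.card * (1 - (ratioBound πe πb : ℝ)⁻¹) ^ (n - J.card) *
        successBound γ Δ δ n J.card ≤
      (Measure.pi (pairLaw PS PR πe πb J)).real
        (goodSet (contextRewardLaw PS PR πe) qlo qup ε δ (ε - Δ) J K) := by
  have hne : Nonempty 𝒮 := PS.nonempty_of_neZero
  have hB1 : 1 ≤ ratioBound πe πb := one_le_ratioBound hB
  have hB1' : (1 : ℝ) ≤ ratioBound πe πb := hB1
  have hJn : J.card ≤ n := by simpa using J.card_le_univ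
  have hq : 0 ≤ 1 - (ratioBound πe πb : ℝ)⁻¹ := sub_nonneg.2 (inv_le_one_of_one_le₀ hB1')
  rcases le_or_gt K.card 1 with h1 | h1
  · have := successBound_nonpos (δ := δ) hγ hΔ.1 hδ.1 hn hJn (hK ▸ h1)
    exact (mul_nonpos_of_nonneg_of_nonpos (by positivity) this).trans measureReal_nonneg
  · have hcount : ∀ c ∈ Set.Ioo (0 : ℝ) 1, ∀ k, _ := fun c hc k =>
      pi_real_card_tail_le (contextRewardLaw PS PR πe) (ratioBound πe πb)⁻¹
        (inv_ne_zero (zero_lt_one.trans_le hB1).ne') (pairLaw PS PR πe πb J) K h1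
        (fun i hi => pairLaw_of_mem PS PR hB (hKJ hi)) (fitScore qlo qup (J \ K))
        (measurable_fitScore qlo qup _)
        (fun x x' h => fitScore_congr qlo qup fun i hi => h i (Finset.mem_sdiff.1 hi).2)
        hties hc k
    -- A set difference has at least the difference of the masses, so each binomial event can be
    -- evaluated separately.
    refine le_trans ?_ le_measureReal_sdiff
    rw [hcount (ε - Δ) ⟨by linarith [hΔ.2], by linarith [hΔ.1, hε.2]⟩, hcount ε hε,
      prod_pairLaw_real_univ PS PR hB, ← mul_sub]
    refine mul_le_mul_of_nonneg_left ?_ (by positivity)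
    have := successBound_le hε hγ hΔ hδ hJn (by omega : 1 ≤ ⌈γ * (J.card : ℝ)⌉₊)
    rwa [← hK] at this

end

end PACOPP

end

/-! ### Summation over accepted and calibration sets. -/

theorem theorem3
    {𝒮 𝒜 : Type*} [MeasurableSpace 𝒮] [MeasurableSpace 𝒜]
    -- the bandit: reference measures for the policies, context law, reward law, policies
    (ν : Kernel 𝒮 𝒜) [IsSFiniteKernel ν]
    (PS : Measure 𝒮) [IsProbabilityMeasure PS]
    (PR : Kernel (𝒮 × 𝒜) ℝ) [IsMarkovKernel PR]
    (πe πb : PACOPP.Policy ν)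
    (hB : (PACOPP.ratioBounds πe πb).Nonempty)
    -- the parameters
    (ε δ γ Δ : ℝ) (hε : ε ∈ Set.Ioo (0 : ℝ) 1) (hδ : δ ∈ Set.Ioo (0 : ℝ) 1)
    (hγ : γ ∈ Set.Ioo (0 : ℝ) 1) (hΔ : Δ ∈ Set.Ioo (0 : ℝ) ε)
    (n : ℕ) (hn : 1 ≤ n)
    -- the data `X`, the uniform variables `V` and the splitting randomness `G`
    {Ω : Type*} [MeasurableSpace Ω] (P : Measure Ω) [IsProbabilityMeasure P]
    {𝒢 : Type*} [MeasurableSpace 𝒢]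
    (X : Fin n → Ω → (𝒮 × 𝒜) × ℝ) (V : Fin n → Ω → ℝ) (G : Ω → 𝒢)
    (hXm : ∀ i, Measurable (X i)) (hVm : ∀ i, Measurable (V i)) (hGm : Measurable G)
    (hXlaw : ∀ i, P.map (X i) = PACOPP.obsLaw PS PR πb)
    (hXindep : iIndepFun X P)
    (hVlaw : ∀ i, P.map (V i) = volume.restrict (Set.Icc (0 : ℝ) 1))
    (hVindep : iIndepFun V P)
    (hXV : IndepFun (fun ω i => X i ω) (fun ω i => V i ω) P)
    (hG : IndepFun G (fun ω => (fun i => X i ω, fun i => V i ω)) P)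
    -- the splitting rule and the quantile estimation algorithms
    (σ : PACOPP.SplitRule γ n 𝒢) (qlo qup : PACOPP.QuantileAlg 𝒮)
    -- almost surely, no ties among the calibration scores
    (hties : ∀ᵐ ω ∂P,
      Set.InjOn
        (PACOPP.tau πe πb σ qlo qup (fun i => X i ω) (fun i => V i ω) (G ω))
        (PACOPP.calibSet πe πb σ (fun i => X i ω) (fun i => V i ω) (G ω))) :
    P.real {ω |
        ε - Δ < PACOPP.miscoverage (PACOPP.contextRewardLaw PS PR πe)
          (PACOPP.predictionInterval πe πb σ qlo qup ε δ
            (fun i => X i ω) (fun i => V i ω) (G ω)) ∧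
        PACOPP.miscoverage (PACOPP.contextRewardLaw PS PR πe)
          (PACOPP.predictionInterval πe πb σ qlo qup ε δ
            (fun i => X i ω) (fun i => V i ω) (G ω)) ≤ ε}
      > 1 - δ -
        PACOPP.boundConst (PACOPP.ratioBound πe πb : ℝ) γ ε Δ δ / √(n : ℝ) := by
  open PACOPP in
  have hne : Nonempty 𝒮 := PS.nonempty_of_neZero
  set B : ℝ := (ratioBound πe πb : ℝ) with hBdef
  have hB1 : 1 ≤ B := one_le_ratioBound hB
  set Y : Ω → Fin n → ((𝒮 × 𝒜) × ℝ) × ℝ := fun ω i => (X i ω, V i ω) with hYdef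
  have hYm : Measurable Y := measurable_pi_lambda _ fun i => (hXm i).prodMk (hVm i)
  have hYlaw : P.map Y = Measure.pi fun _ => (obsLaw PS PR πb).prod unif :=
    map_prodMk_eq_pi hXm hVm hXlaw hXindep hVlaw hVindep hXV
  have hGY : IndepFun G Y P := by
    have hφ : Measurable fun p : (Fin n → (𝒮 × 𝒜) × ℝ) × (Fin n → ℝ) =>
        fun i => (p.1 i, p.2 i) := by fun_prop
    exact hG.comp measurable_id hφ
  set S := {ω | ε - Δ < miscoverage (contextRewardLaw PS PR πe)
          (predictionInterval πe πb σ qlo qup ε δ (fun i => X i ω) (fun i => V i ω) (G ω)) ∧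
        miscoverage (contextRewardLaw PS PR πe)
          (predictionInterval πe πb σ qlo qup ε δ (fun i => X i ω) (fun i => V i ω) (G ω)) ≤ ε}
    with hS
  set Q := contextRewardLaw PS PR πe with hQ
  set A : Finset (Fin n) → Finset (Fin n) → Set 𝒢 := fun J K => {g | σ.calib g J = K} with hA
  have hAm : ∀ J K, MeasurableSet (A J K) := σ.measurableSet_calib
  -- These disjoint measurable events lie inside the success event, so measurability of the latter
  -- is not needed.
  set Ev : Finset (Fin n) × Finset (Fin n) → Set Ω := fun T =>
    G ⁻¹' A T.1 T.2 ∩ Y ⁻¹' (pairsOf ⁻¹' goodSet Q qlo qup ε δ (ε - Δ) T.1 T.2 ∩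
      acceptBox πe πb T.1) with hEv
  have hEvm : ∀ T, MeasurableSet (Ev T) := fun T =>
    (hGm (hAm _ _)).inter (hYm ((measurable_pairsOf
      (measurableSet_goodSet Q qlo qup ε δ (ε - Δ) T.1 T.2)).inter
        (measurableSet_acceptBox πe πb T.1)))
  have hacc : ∀ J ω, Y ω ∈ acceptBox πe πb J ↔
      accepted πe πb (fun i => X i ω) (fun i => V i ω) = J := fun J ω =>
    mem_acceptBox_iff πe πb J _ _
  have hEvS : ∀ T, Ev T ⊆ S := by
    rintro ⟨J, K⟩ ω ⟨hω1, hω2, hω3⟩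
    have hJ := (hacc J ω).1 hω3
    have hK : σ.calib (G ω) J = K := hω1
    have hx : (fun i => contextReward (X i ω)) ∈ goodSet Q qlo qup ε δ (ε - Δ) J K := hω2
    exact miscoverage_predictionInterval_mem πe πb σ hδ.1.le hJ hK hx
  have hdisj : ((Finset.univ : Finset (Finset (Fin n) × Finset (Fin n))) : Set _).PairwiseDisjoint
      Ev := by
    rintro ⟨J, K⟩ _ ⟨J', K'⟩ _ hTT
    rw [Function.onFun, Set.disjoint_left]
    rintro ω ⟨h1, -, h3⟩ ⟨h1', -, h3'⟩
    have hJ : J = J' := ((hacc J ω).1 h3).symm.trans ((hacc J' ω).1 h3')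
    subst hJ
    have hK : σ.calib (G ω) J = K := h1
    have hK' : σ.calib (G ω) J = K' := h1'
    exact hTT (Prod.ext rfl (hK.symm.trans hK'))
  have hEvle : ∀ J K, P.real (G ⁻¹' A J K) *
      (B⁻¹ ^ J.card * (1 - B⁻¹) ^ (n - J.card) * successBound γ Δ δ n J.card) ≤
        P.real (Ev (J, K)) := by
    intro J K
    have hreal : P.real (Ev (J, K)) = P.real (G ⁻¹' A J K) *
        (Measure.pi (pairLaw PS PR πe πb J)).real (goodSet Q qlo qup ε δ (ε - Δ) J K) := by
      simp only [Measure.real, hEv]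
      rw [measure_split_inter_accept PS PR hYm hYlaw hGY J (hAm J K)
        (measurableSet_goodSet Q qlo qup ε δ (ε - Δ) J K), ENNReal.toReal_mul]
    rw [hreal]
    rcases eq_or_ne (P (G ⁻¹' A J K)) 0 with h0 | h0
    · simp [Measure.real, h0]
    · obtain ⟨ω0, hω0⟩ := nonempty_of_measure_ne_zero h0
      have hK : σ.calib (G ω0) J = K := hω0
      refine mul_le_mul_of_nonneg_left ?_ measureReal_nonneg
      refine le_measureReal_goodSet PS PR hB hε hδ hγ hΔ hn qlo qup
        (hK ▸ σ.calib_subset _ _) (hK ▸ σ.card_calib _ _) ?_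
      have hT := measurableSet_ties qlo qup (J \ K) K
      have hz := measure_split_inter_accept PS PR (πe := πe) hYm hYlaw hGY J (hAm J K) hT
      have hnull : P (G ⁻¹' A J K ∩ Y ⁻¹' (pairsOf ⁻¹' {x : Fin n → 𝒮 × ℝ |
          ¬ Set.InjOn (fun i => fitScore qlo qup (J \ K) x (x i)) K} ∩
            acceptBox πe πb J)) = 0 := by
        refine measure_mono_null ?_ (ae_iff.1 hties)
        rintro ω ⟨hω1, hω2, hω3⟩ hinj
        have hJ := (hacc J ω).1 hω3
        have hK : σ.calib (G ω) J = K := hω1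
        have htau : tau πe πb σ qlo qup (fun i => X i ω) (fun i => V i ω) (G ω) = _ :=
          funext fun i => tau_eq_fitScore πe πb σ qlo qup hJ hK i
        rw [htau, calibSet, hJ, hK] at hinj
        exact hω2 hinj
      rw [hnull] at hz
      rw [ae_iff]
      exact (mul_eq_zero.1 hz.symm).resolve_left h0
  have hsplit : ∀ J, ∑ K, P.real (G ⁻¹' A J K) = 1 := by
    intro J
    have hU : (⋃ K ∈ (Finset.univ : Finset (Finset (Fin n))), G ⁻¹' A J K) = Set.univ := by
      ext ω
      simp [hA]
    rw [← measureReal_biUnion_finset, hU, probReal_univ]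
    · intro K _ K' _ hne
      rw [Function.onFun, Set.disjoint_left]
      intro ω h h'
      exact hne (Eq.trans (Eq.symm h) h')
    · exact fun K _ => hGm (hAm J K)
  have hsqrt : 0 < √(n : ℝ) := Real.sqrt_pos.2 (by exact_mod_cast hn)
  have hloss := lossCoeff_mul_lt_boundConst hε hγ hΔ hδ hB1
  calc 1 - δ - boundConst B γ ε Δ δ / √(n : ℝ)
      < 1 - δ - lossCoeff γ Δ δ * B / √(n : ℝ) := by gcongr
    _ ≤ ∑ N ∈ Finset.range (n + 1), binPMF n B⁻¹ N * successBound γ Δ δ n N :=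
        le_sum_binPMF_successBound hγ.1 hΔ.1 hB1 n
    _ = ∑ J : Finset (Fin n),
          B⁻¹ ^ J.card * (1 - B⁻¹) ^ (n - J.card) * successBound γ Δ δ n J.card := by
        rw [← Finset.powerset_univ, Finset.sum_powerset_apply_card (fun N =>
          B⁻¹ ^ N * (1 - B⁻¹) ^ (n - N) * successBound γ Δ δ n N), Finset.card_univ,
          Fintype.card_fin]
        refine Finset.sum_congr rfl fun N _ => ?_
        rw [binPMF, nsmul_eq_mul]
        ring
    _ = ∑ J : Finset (Fin n), ∑ K : Finset (Fin n), P.real (G ⁻¹' A J K) *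
          (B⁻¹ ^ J.card * (1 - B⁻¹) ^ (n - J.card) * successBound γ Δ δ n J.card) := by
        refine Finset.sum_congr rfl fun J _ => ?_
        rw [← Finset.sum_mul, hsplit, one_mul]
    _ ≤ ∑ J : Finset (Fin n), ∑ K : Finset (Fin n), P.real (Ev (J, K)) :=
        Finset.sum_le_sum fun J _ => Finset.sum_le_sum fun K _ => hEvle J K
    _ = ∑ T : Finset (Fin n) × Finset (Fin n), P.real (Ev T) :=
        (Fintype.sum_prod_type fun T => P.real (Ev T)).symm
    _ = P.real (⋃ T ∈ (Finset.univ : Finset (Finset (Fin n) × Finset (Fin n))), Ev T) :=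
        (measureReal_biUnion_finset hdisj fun T _ => hEvm T).symm
    _ ≤ P.real S := measureReal_mono (Set.iUnion₂_subset fun T _ => hEvS T)
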